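/- An overpartition of a nonnegative integer $n$ is a partition of $n$ in which the first occurrence of each distinct part may be overlined. Let $\overline{S}_9(n)$ denote the number of $9$-Schur overpartitions of $n$, that is, of overpartitions of $n$ all of whose parts are congruent modulo $18$ to an element of $\{1,3,5,7,\dots,17\}\setminus\{9\}$; equivalently, $$\sum_{n\ge 0}\overline{S}_9(n)q^n=\prod_{n\ge 1}\frac{(1+q^{2n-1})(1-q^{9(2n-1)})}{(1+q^{9(2n-1)})(1-q^{2n-1})}.$$ Then for all integers $n\ge 0$ and $\alpha\ge 0$, \begin{align*} \overline{S}_9(12n+7)&\equiv 0 \pmod 8,\\ \overline{S}_9(6n+3)&\equiv (-1)^{\alpha}\,\overline{S}_9\big(3^{\alpha}(6n+3)\big) \pmod{16},\\ \overline{S}_9(6n+5)&\equiv \overline{S}_9\big(3^{\alpha}(6n+5)\big) \pmod{16},\\ \overline{S}_9(24n+23)&\equiv 0 \pmod{32}. \end{align*} -/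

import Mathlib

/-- The residues `I(t) = {1, 3, 5, …, 2t - 1} \ {t}`. -/
def schurResidues (t : ℕ) : Finset ℕ :=
  ((Finset.range (2 * t)).filter (fun i => Odd i)).erase t

/-- The overpartitions of `n`. An overpartition is a partition `p` of `n` in which the first
occurrence of each distinct part may be overlined; it is recorded as the pair `⟨p, o⟩`, where `o`
is the set of those distinct parts of `p` whose first occurrence is overlined. -/
def overpartitions (n : ℕ) : Finset (Σ _ : n.Partition, Finset ℕ) :=
  (Finset.univ : Finset n.Partition).sigma (fun p => p.parts.toFinset.powerset)

/-- The `t`-Schur overpartitions of `n`: the overpartitions of `n` all of whose parts are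
congruent modulo `2t` to an element of `I(t)`. -/
def schurOverpartitions (t n : ℕ) : Finset (Σ _ : n.Partition, Finset ℕ) :=
  (overpartitions n).filter (fun π => ∀ a ∈ π.1.parts, a % (2 * t) ∈ schurResidues t)

/-- The number of `t`-Schur overpartitions of `n`. -/
def schurOverpartitionCount (t n : ℕ) : ℕ :=
  (schurOverpartitions t n).card

/-!
Write `φ(q) = ∑ q ^ (k ^ 2)`, `ψ(q) = ∑ q ^ (2 k ^ 2 + k)` and `Ω(q) = ∑ q ^ (3 k ^ 2 + 2 k)`, all
sums being over the integers. The Jacobi triple product (`theta_eq_tprod`) turns the product for the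
generating function of `S̄₉` into the quotient `φ(q) φ(-q ^ 18) / (φ(-q ^ 2) φ(q ^ 9))`
(`schurSeries_nine_mul`).

Since `φ(q) = φ(q ^ 9) + 2 q Ω(q ^ 3)`, the sections of this quotient modulo three are explicit. Of
the parts of fixed parity of the result only the series `K` survives, where `K(q ^ 2)` is the even
part of `Ω(q) φ(-q ^ 3)`, with a factor `2`, `4` or `8` in front (`exists_schurSection_mul_eq`). As
`φ ≡ 1 (mod 2)`, most other factors disappear modulo four, and `exists_schurSection_eq` gives the
following evaluations, in which the cofactor of the leading `2`, `4` or `8` is meant modulo four: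
* `∑ S̄₉(6 n + 1) q ^ n = 2 K`,
* `∑ S̄₉(6 n + 3) q ^ n = 4 φ(q ^ 3) K Ω(-q)`,
* `∑ S̄₉(6 n + 5) q ^ n = 8 K Ω(-q) ^ 2`.

The series `K` is itself even, which is the congruence modulo `8`, and the terms of odd degree of
`K Ω(-q) ^ 2` modulo four have degree `4 n + 1`, which is the congruence modulo `32`.

For the congruences modulo `16` let `f(q, q ^ 2) = ∑ q ^ ((3 k ^ 2 + k) / 2)`. Up to theta factors
congruent to `1` modulo two and series in `q ^ 3`, the terms of `φ(q ^ 3) K Ω(-q)` are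
`Ω(-q) f(q ^ 4, q ^ 8)` and `2 q ^ 2 Ω(q) Ω(q ^ 2)`, whose exponents are given by the norm form
`x ^ 2 + 2 y ^ 2`. Multiplication by `1 + √-2`, an element of norm three, acts on these
representations and yields the sections of both products modulo three
(`progSection_three_one_omegaTheta_mul` and its companions); the sign in `S̄₉(3 m) ≡ -S̄₉(m)`, for
`m ≡ 3 (mod 6)`, is there because `e` and `3 e + 1` have opposite parity. The terms with a factor
two only matter modulo two. There the triple product expresses everything through `P = ψ(q)`,
`R = ψ(q ^ 3)` and `f(q, q ^ 2)`, subject to `P R = P ^ 4 + q R ^ 4` (`psi_mul_ex_three_psi_two`),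
and what remains is the evaluation of a sum of four copies of `(φ - 1) / 2`, which is determined by
an Artin–Schreier equation (`halfPhiSum_mul_psi_two`). The two ingredients are combined in
`progSection_three_mod_four`.
-/

open PowerSeries

/-! ### Counting series and arithmetic-progression sections -/

/-- The power series `∑ᵢ X ^ e i` of a family of exponents with finite fibres: its `n`-th
coefficient is the number of `i` with `e i = n`. -/
noncomputable def countSeries (R : Type*) [CommRing R] {ι : Type*} (e : ι → ℕ) : R⟦X⟧ :=
  mk fun n => ((e ⁻¹' {n}).ncard : R)

/-- The section `∑ₙ a (m n + r) X ^ n` of a power series `∑ₙ a n X ^ n`. -/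
noncomputable def progSection {R : Type*} [CommRing R] (m r : ℕ) : R⟦X⟧ →ₗ[R] R⟦X⟧ where
  toFun A := mk fun n => coeff (m * n + r) A
  map_add' A B := by ext; simp
  map_smul' c A := by ext; simp

section Series

variable {R : Type*} [CommRing R] {ι κ : Type*}

@[simp]
lemma coeff_progSection (m r n : ℕ) (A : R⟦X⟧) :
    coeff n (progSection m r A) = coeff (m * n + r) A := by
  simp [progSection]

@[simp]
lemma coeff_countSeries (e : ι → ℕ) (n : ℕ) :
    coeff n (countSeries R e) = ((e ⁻¹' {n}).ncard : R) := by
  simp [countSeries]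

lemma map_countSeries {S : Type*} [CommRing S] (f : R →+* S) (e : ι → ℕ) :
    map f (countSeries R e) = countSeries S e := by
  ext; simp

lemma countSeries_congr {e : ι → ℕ} {e' : κ → ℕ} (σ : ι → κ) (hσ : Function.Bijective σ)
    (h : ∀ i, e' (σ i) = e i) : countSeries R e = countSeries R e' := by
  ext n
  have : e' ⁻¹' {n} = σ '' (e ⁻¹' {n}) := by
    ext j
    obtain ⟨i, rfl⟩ := hσ.2 j
    simp [h, hσ.1.eq_iff]
  rw [coeff_countSeries, coeff_countSeries, this, Set.ncard_image_of_injective _ hσ.1]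

lemma countSeries_sumElim {e : ι → ℕ} {e' : κ → ℕ} (he : ∀ n, (e ⁻¹' {n}).Finite)
    (he' : ∀ n, (e' ⁻¹' {n}).Finite) :
    countSeries R (Sum.elim e e') = countSeries R e + countSeries R e' := by
  ext n
  have : Sum.elim e e' ⁻¹' {n} = Sum.inl '' (e ⁻¹' {n}) ∪ Sum.inr '' (e' ⁻¹' {n}) := by
    ext (i | j) <;> simp
  rw [map_add, coeff_countSeries, coeff_countSeries, coeff_countSeries, this,
    Set.ncard_union_eq ?_ ((he n).image _) ((he' n).image _),
    Set.ncard_image_of_injective _ Sum.inl_injective,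
    Set.ncard_image_of_injective _ Sum.inr_injective, Nat.cast_add]
  rw [Set.disjoint_left]
  rintro _ ⟨i, -, rfl⟩ ⟨j, -, h⟩
  simp at h

lemma finite_fiber_add {e : ι → ℕ} {e' : κ → ℕ} (he : ∀ n, (e ⁻¹' {n}).Finite)
    (he' : ∀ n, (e' ⁻¹' {n}).Finite) (n : ℕ) :
    ((fun p : ι × κ => e p.1 + e' p.2) ⁻¹' {n}).Finite := by
  refine ((Set.finite_Iic n).biUnion fun i _ => (Set.finite_Iic n).biUnion fun j _ =>
    (he i).prod (he' j)).subset ?_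
  rintro ⟨i, j⟩ h
  simp only [Set.mem_preimage, Set.mem_singleton_iff] at h
  simp only [Set.mem_iUnion, Set.mem_prod, Set.mem_preimage, Set.mem_singleton_iff, Set.mem_Iic]
  exact ⟨_, by omega, _, by omega, rfl, rfl⟩

lemma finite_fiber_affine {e : ι → ℕ} (he : ∀ n, (e ⁻¹' {n}).Finite) {m : ℕ} (hm : m ≠ 0)
    (r n : ℕ) : ((fun i => m * e i + r) ⁻¹' {n}).Finite := by
  refine (he ((n - r) / m)).subset fun i h => ?_
  simp only [Set.mem_preimage, Set.mem_singleton_iff] at h ⊢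
  rw [← h, Nat.add_sub_cancel, Nat.mul_div_cancel_left _ (Nat.pos_of_ne_zero hm)]

lemma finite_fiber_mul {e : ι → ℕ} (he : ∀ n, (e ⁻¹' {n}).Finite) {m : ℕ} (hm : m ≠ 0)
    (n : ℕ) : ((fun i => m * e i) ⁻¹' {n}).Finite :=
  finite_fiber_affine he hm 0 n

lemma finite_fiber_sumElim {e : ι → ℕ} {e' : κ → ℕ} (he : ∀ n, (e ⁻¹' {n}).Finite)
    (he' : ∀ n, (e' ⁻¹' {n}).Finite) (n : ℕ) : (Sum.elim e e' ⁻¹' {n}).Finite := by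
  have : Sum.elim e e' ⁻¹' {n} = Sum.inl '' (e ⁻¹' {n}) ∪ Sum.inr '' (e' ⁻¹' {n}) := by
    ext (i | j) <;> simp
  rw [this]
  exact ((he n).image _).union ((he' n).image _)

lemma countSeries_mul {e : ι → ℕ} {e' : κ → ℕ} (he : ∀ n, (e ⁻¹' {n}).Finite)
    (he' : ∀ n, (e' ⁻¹' {n}).Finite) :
    countSeries R e * countSeries R e' =
      countSeries R (fun p : ι × κ => e p.1 + e' p.2) := by
  ext n
  have hcard : ((fun p : ι × κ => e p.1 + e' p.2) ⁻¹' {n}).ncard =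
      ∑ a ∈ Finset.HasAntidiagonal.antidiagonal n,
        (e ⁻¹' {a.1}).ncard * (e' ⁻¹' {a.2}).ncard := by
    classical
    rw [Set.ncard_eq_toFinset_card _ (finite_fiber_add he he' n),
      Finset.card_eq_sum_card_fiberwise (f := fun p : ι × κ => (e p.1, e' p.2))
        (t := Finset.HasAntidiagonal.antidiagonal n) (fun p hp => by simpa using hp)]
    refine Finset.sum_congr rfl fun a ha => ?_
    rw [← Set.ncard_prod, ← Set.ncard_coe_finset]
    congr 1
    ext p
    have := Finset.HasAntidiagonal.mem_antidiagonal.1 ha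
    simp only [Finset.coe_filter, Set.Finite.mem_toFinset, Set.mem_preimage,
      Set.mem_singleton_iff, Set.mem_prod, Prod.ext_iff]
    change (_ ∧ _ ∧ _) ↔ _
    constructor
    · exact fun h => h.2
    · rintro ⟨h1, h2⟩
      exact ⟨by rw [h1, h2, this], h1, h2⟩
  rw [coeff_mul, coeff_countSeries, hcard]
  simp

lemma X_pow_mul_countSeries (r : ℕ) (e : ι → ℕ) :
    X ^ r * countSeries R e = countSeries R (fun i => e i + r) := by
  ext n
  rw [coeff_X_pow_mul', coeff_countSeries, coeff_countSeries]
  split_ifs with h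
  · congr 2
    ext i
    simp only [Set.mem_preimage, Set.mem_singleton_iff]
    omega
  · have : (fun i => e i + r) ⁻¹' {n} = ∅ := by
      ext i
      simp only [Set.mem_preimage, Set.mem_singleton_iff, Set.mem_empty_iff_false, iff_false]
      omega
    simp [this]

lemma expand_countSeries {m : ℕ} (hm : m ≠ 0) (e : ι → ℕ) :
    expand m hm (countSeries R e) = countSeries R (fun i => m * e i) := by
  ext n
  rw [coeff_expand, coeff_countSeries, coeff_countSeries]
  split_ifs with h
  · obtain ⟨k, rfl⟩ := h
    congr 2
    ext i
    simp [hm, Nat.mul_div_cancel_left _ (Nat.pos_of_ne_zero hm)]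
  · have : (fun i => m * e i) ⁻¹' {n} = ∅ := by
      ext i
      simp only [Set.mem_preimage, Set.mem_singleton_iff, Set.mem_empty_iff_false, iff_false]
      rintro rfl
      exact h ⟨_, rfl⟩
    simp [this]

/-- A section of a counting series is again a counting series, as soon as the indices with
exponent `≡ r (mod m)` are parametrized injectively. -/
lemma progSection_countSeries {m r : ℕ} (hm : m ≠ 0) {e : ι → ℕ} {e' : κ → ℕ} (σ : κ → ι)
    (hσ : Function.Injective σ) (h : ∀ j, e (σ j) = m * e' j + r)
    (hr : ∀ i k, e i = m * k + r → ∃ j, σ j = i) :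
    progSection m r (countSeries R e) = countSeries R e' := by
  ext n
  have : e ⁻¹' {m * n + r} = σ '' (e' ⁻¹' {n}) := by
    ext i
    simp only [Set.mem_preimage, Set.mem_singleton_iff, Set.mem_image]
    constructor
    · intro hi
      obtain ⟨j, rfl⟩ := hr i n hi
      rw [h] at hi
      exact ⟨j, Nat.eq_of_mul_eq_mul_left (Nat.pos_of_ne_zero hm) (by omega), rfl⟩
    · rintro ⟨j, rfl, rfl⟩
      exact h j
  rw [coeff_progSection, coeff_countSeries, coeff_countSeries, this,
    Set.ncard_image_of_injective _ hσ]

lemma progSection_expand_mul {m r : ℕ} (hm : m ≠ 0) (hr : r < m) (A B : R⟦X⟧) :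
    progSection m r (expand m hm A * B) = A * progSection m r B := by
  ext n
  rw [coeff_progSection, coeff_mul, coeff_mul]
  symm
  refine Finset.sum_of_injOn (fun p => (m * p.1, m * p.2 + r)) ?_ ?_ ?_ ?_
  · rintro ⟨a, b⟩ - ⟨c, d⟩ - h
    simp only [Prod.mk.injEq, Nat.add_right_cancel_iff, Nat.mul_right_inj hm] at h
    rw [h.1, h.2]
  · rintro ⟨a, b⟩ h
    simp only [Finset.mem_coe, Finset.HasAntidiagonal.mem_antidiagonal] at h ⊢
    rw [← h]; ring
  · rintro ⟨a, b⟩ h h'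
    simp only [Finset.HasAntidiagonal.mem_antidiagonal] at h
    rw [coeff_expand]
    split_ifs with hd
    · exfalso
      obtain ⟨c, rfl⟩ := hd
      refine h' ⟨(c, n - c), ?_, ?_⟩
      · have : c ≤ n := by
          by_contra hc
          have : m * (n + 1) ≤ m * c := Nat.mul_le_mul_left _ (by omega)
          rw [mul_add] at this
          omega
        simp [this]
      · have : c ≤ n := by
          by_contra hc
          have : m * (n + 1) ≤ m * c := Nat.mul_le_mul_left _ (by omega)
          rw [mul_add] at this
          omega
        obtain ⟨d, rfl⟩ := Nat.exists_eq_add_of_le this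
        rw [mul_add] at h
        simp only [Nat.add_sub_cancel_left, Prod.mk.injEq, true_and]
        omega
    · simp
  · rintro ⟨a, b⟩ -
    simp

lemma progSection_expand (m : ℕ) (hm : m ≠ 0) (A : R⟦X⟧) :
    progSection m 0 (expand m hm A) = A := by
  ext n; simp

lemma progSection_X_pow_mul_expand {m r s : ℕ} (hm : m ≠ 0) (hr : r < m) (hs : s < m)
    (A : R⟦X⟧) : progSection m r (X ^ s * expand m hm A) = if r = s then A else 0 := by
  have h1 : progSection m r (X ^ s : R⟦X⟧) = if r = s then 1 else 0 := by
    ext n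
    rw [coeff_progSection, coeff_X_pow]
    by_cases h : r = s
    · subst h
      simp [coeff_one, hm]
    · rw [if_neg h, if_neg, map_zero]
      intro h'
      rcases Nat.eq_zero_or_pos n with rfl | hn
      · omega
      · nlinarith
  rw [mul_comm, progSection_expand_mul hm hr, h1]
  split_ifs <;> simp

lemma expand_injective {m : ℕ} (hm : m ≠ 0) : Function.Injective (expand m hm : R⟦X⟧ → R⟦X⟧) :=
  fun A B h => by rw [← progSection_expand m hm A, h, progSection_expand]

lemma rescale_neg_one_expand_two (A : R⟦X⟧) :
    rescale (-1 : R) (expand 2 two_ne_zero A) = expand 2 two_ne_zero A := by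
  ext n
  rw [coeff_rescale, coeff_expand]
  split_ifs with h
  · rw [(even_iff_two_dvd.2 h).neg_one_pow, one_mul]
  · simp

lemma rescale_neg_one_expand_of_odd {m : ℕ} (hm : m ≠ 0) (h : Odd m) (A : R⟦X⟧) :
    rescale (-1 : R) (expand m hm A) = expand m hm (rescale (-1 : R) A) := by
  ext n
  rw [coeff_rescale, coeff_expand, coeff_expand]
  split_ifs with hd
  · obtain ⟨k, rfl⟩ := hd
    rw [Nat.mul_div_cancel_left _ h.pos, coeff_rescale, pow_mul, h.neg_one_pow]
  · simp

end Series

/-! ### The Jacobi triple product -/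

/-- The `q`-Pochhammer symbol `(q; q)ₙ = ∏_{i = 1}^{n} (1 - q ^ i)`. -/
def qFactorial {R : Type*} [CommRing R] (q : R) (n : ℕ) : R :=
  ∏ i ∈ Finset.range n, (1 - q ^ (i + 1))

/-- The Gaussian binomial coefficient `[n, k]_q`, defined by the `q`-Pascal rule. -/
def gaussBinom {R : Type*} [CommRing R] (q : R) : ℕ → ℕ → R
  | _, 0 => 1
  | 0, _ + 1 => 0
  | n + 1, k + 1 => gaussBinom q n k + q ^ (k + 1) * gaussBinom q n (k + 1)

section GaussBinom

variable {R : Type*} [CommRing R] (q : R)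

@[simp]
lemma gaussBinom_zero_right (n : ℕ) : gaussBinom q n 0 = 1 := by
  cases n <;> rfl

lemma gaussBinom_succ_succ (n k : ℕ) :
    gaussBinom q (n + 1) (k + 1) = gaussBinom q n k + q ^ (k + 1) * gaussBinom q n (k + 1) := rfl

lemma gaussBinom_eq_zero {n k : ℕ} (h : n < k) : gaussBinom q n k = 0 := by
  induction n generalizing k with
  | zero => obtain ⟨k, rfl⟩ := Nat.exists_eq_succ_of_ne_zero (by omega : k ≠ 0); rfl
  | succ n ih =>
    obtain ⟨k, rfl⟩ := Nat.exists_eq_succ_of_ne_zero (by omega : k ≠ 0)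
    rw [Nat.succ_eq_add_one, gaussBinom_succ_succ, ih (by omega), ih (by omega)]
    simp

lemma qFactorial_succ (n : ℕ) :
    qFactorial q (n + 1) = qFactorial q n * (1 - q ^ (n + 1)) := Finset.prod_range_succ _ _

lemma gaussBinom_mul_qFactorial (n k j : ℕ) (h : k + j = n) :
    gaussBinom q n k * qFactorial q k * qFactorial q j = qFactorial q n := by
  induction n generalizing k j with
  | zero =>
    obtain ⟨rfl, rfl⟩ : k = 0 ∧ j = 0 := by omega
    simp [qFactorial]
  | succ n ih =>
    rcases k with _ | k
    · obtain rfl : j = n + 1 := by omega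
      simp [qFactorial]
    rcases j with _ | j
    · obtain rfl : k = n := by omega
      have := ih k 0 rfl
      rw [gaussBinom_succ_succ, gaussBinom_eq_zero q (Nat.lt_succ_self k), qFactorial_succ]
      linear_combination (1 - q ^ (k + 1)) * this
    · have h1 := ih k (j + 1) (by omega)
      have h2 := ih (k + 1) j (by omega)
      obtain rfl : n = k + j + 1 := by omega
      rw [qFactorial_succ q j] at h1
      rw [qFactorial_succ q k] at h2
      rw [gaussBinom_succ_succ, qFactorial_succ q k, qFactorial_succ q j,
        qFactorial_succ q (k + j + 1)]
      linear_combination (1 - q ^ (k + 1)) * h1 + q ^ (k + 1) * (1 - q ^ (j + 1)) * h2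

/-- The `q`-binomial theorem, in homogeneous form. -/
lemma prod_add_mul_pow_eq_sum_gaussBinom (u v : R) (n : ℕ) :
    ∏ i ∈ Finset.range n, (u + v * q ^ i) =
      ∑ k ∈ Finset.range (n + 1), gaussBinom q n k * q ^ (k.choose 2) * v ^ k * u ^ (n - k) := by
  induction n generalizing v with
  | zero => simp
  | succ n ih =>
    have h : ∏ i ∈ Finset.range n, (u + v * q ^ (i + 1)) =
        ∏ i ∈ Finset.range n, (u + (v * q) * q ^ i) :=
      Finset.prod_congr rfl fun i _ => by ring
    have h1 : ∑ k ∈ Finset.range (n + 1),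
        (gaussBinom q n k + q ^ (k + 1) * gaussBinom q n (k + 1)) * q ^ (k + k.choose 2) *
          v ^ (k + 1) * u ^ (n + 1 - (k + 1)) =
        v * (∑ k ∈ Finset.range (n + 1),
          gaussBinom q n k * q ^ (k.choose 2) * (v * q) ^ k * u ^ (n - k)) +
        u * ∑ k ∈ Finset.range n,
          gaussBinom q n (k + 1) * q ^ ((k + 1).choose 2) * (v * q) ^ (k + 1) *
            u ^ (n - (k + 1)) := by
      have h2 : u * ∑ k ∈ Finset.range n,
          gaussBinom q n (k + 1) * q ^ ((k + 1).choose 2) * (v * q) ^ (k + 1) *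
            u ^ (n - (k + 1)) = ∑ k ∈ Finset.range (n + 1),
          gaussBinom q n (k + 1) * q ^ (k + k.choose 2) * (v * q) ^ (k + 1) *
            u ^ (n - k) := by
        rw [Finset.sum_range_succ, gaussBinom_eq_zero q (Nat.lt_succ_self n), Finset.mul_sum]
        simp only [zero_mul, add_zero]
        refine Finset.sum_congr rfl fun k hk => ?_
        rw [Finset.mem_range] at hk
        rw [Nat.choose_succ_succ' _ 1, Nat.choose_one_right,
          show n - k = n - (k + 1) + 1 by omega]
        ring
      rw [h2, Finset.mul_sum, ← Finset.sum_add_distrib]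
      refine Finset.sum_congr rfl fun k _ => ?_
      rw [Nat.add_sub_add_right]
      ring
    have h3 := Finset.sum_range_succ' (fun k =>
      gaussBinom q n k * q ^ (k.choose 2) * (v * q) ^ k * u ^ (n - k)) n
    rw [Finset.prod_range_succ', h, ih, Finset.sum_range_succ' _ (n + 1)]
    simp only [gaussBinom_succ_succ, Nat.choose_succ_succ' _ 1, Nat.choose_one_right]
    simp only [Nat.choose_succ_succ' _ 1, Nat.choose_one_right] at h1 h3
    simp only [one_add_one_eq_two] at h1 h3 ⊢
    rw [h1]
    simp only [gaussBinom_zero_right, Nat.choose_zero_succ, pow_zero, Nat.sub_zero, mul_one,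
      one_mul] at h3 ⊢
    linear_combination u * h3

end GaussBinom

/-- The exponent `a k (k + 1) / 2 + b k (k - 1) / 2` of Ramanujan's theta function
`f(q ^ a, q ^ b)`. -/
def thetaExp (a b : ℕ) (k : ℤ) : ℕ :=
  ((a * (k * (k + 1)) + b * (k * (k - 1))) / 2).toNat

lemma thetaExp_nonneg_aux (a b : ℕ) (k : ℤ) :
    0 ≤ (a : ℤ) * (k * (k + 1)) ∧ 0 ≤ (b : ℤ) * (k * (k - 1)) := by
  constructor
  · refine mul_nonneg (Int.natCast_nonneg _) ?_
    rcases le_or_gt 0 k with h | h <;> nlinarith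
  · refine mul_nonneg (Int.natCast_nonneg _) ?_
    rcases le_or_gt k 0 with h | h <;> nlinarith

lemma two_mul_thetaExp (a b : ℕ) (k : ℤ) :
    2 * (thetaExp a b k : ℤ) = (a + b) * k ^ 2 + (a - b) * k := by
  obtain ⟨h1, h2⟩ := thetaExp_nonneg_aux a b k
  rw [thetaExp, Int.toNat_of_nonneg (by omega), Int.mul_ediv_cancel']
  · ring
  · refine dvd_add (Dvd.dvd.mul_left ?_ _) (Dvd.dvd.mul_left ?_ _)
    · exact (Int.even_mul_succ_self k).two_dvd
    · exact (Int.even_mul_pred_self k).two_dvd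

lemma abs_le_thetaExp {a b : ℕ} (ha : 1 ≤ a) (hb : 1 ≤ b) (k : ℤ) :
    |k| ≤ thetaExp a b k := by
  have h := two_mul_thetaExp a b k
  have h1 : 0 ≤ ((a : ℤ) - 1) * (k * (k + 1)) := by
    obtain ⟨a, rfl⟩ := Nat.exists_eq_add_of_le ha
    simpa using (thetaExp_nonneg_aux a b k).1
  have h2 : 0 ≤ ((b : ℤ) - 1) * (k * (k - 1)) := by
    obtain ⟨b, rfl⟩ := Nat.exists_eq_add_of_le hb
    simpa using (thetaExp_nonneg_aux a b k).2
  have h3 : |k| ≤ k ^ 2 := by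
    rw [← sq_abs]
    rcases eq_or_ne k 0 with rfl | h0
    · simp
    · have := Int.one_le_abs h0
      nlinarith
  nlinarith

lemma finite_fiber_thetaExp {a b : ℕ} (ha : 1 ≤ a) (hb : 1 ≤ b) (n : ℕ) :
    (thetaExp a b ⁻¹' {n}).Finite := by
  refine (Set.finite_Icc (-(n : ℤ)) n).subset fun k hk => ?_
  have := abs_le_thetaExp ha hb k
  rw [Set.mem_preimage, Set.mem_singleton_iff] at hk
  rw [hk] at this
  exact abs_le.1 this

/-- Ramanujan's theta function `f(q ^ a, q ^ b) = ∑ₖ q ^ (a k (k + 1) / 2 + b k (k - 1) / 2)`,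
with `k` running over all integers. -/
noncomputable def theta (R : Type*) [CommRing R] (a b : ℕ) : R⟦X⟧ :=
  countSeries R (thetaExp a b)

lemma constantCoeff_theta {R : Type*} [CommRing R] {a b : ℕ} (ha : 1 ≤ a) (hb : 1 ≤ b) :
    constantCoeff (theta R a b) = 1 := by
  have h : thetaExp a b ⁻¹' {0} = {0} := by
    ext k
    rw [Set.mem_preimage, Set.mem_singleton_iff, Set.mem_singleton_iff]
    constructor
    · intro hk
      have := abs_le_thetaExp ha hb k
      rwa [hk, Nat.cast_zero, abs_nonpos_iff] at this
    · rintro rfl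
      simp [thetaExp]
  rw [← coeff_zero_eq_constantCoeff_apply, theta, coeff_countSeries, h]
  simp

section TripleProduct

variable (R : Type*) [CommRing R]

/-- The finite form of the triple product identity: the `q`-binomial theorem for `2 n` factors
`q ^ (c n) + q ^ a q ^ (c i)`, where `c = a + b`, divided by a power of `q`. -/
lemma prod_mul_prod_eq_sum_gaussBinom (a b n : ℕ) :
    (∏ i ∈ Finset.range n, (1 + X ^ (a + (a + b) * i) : R⟦X⟧)) *
        ∏ i ∈ Finset.range n, (1 + X ^ (b + (a + b) * i) : R⟦X⟧) =
      ∑ k ∈ Finset.range (2 * n + 1),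
        gaussBinom (X ^ (a + b) : R⟦X⟧) (2 * n) k * X ^ thetaExp a b ((k : ℤ) - n) := by
  -- the power of `q` common to both sides of the `q`-binomial theorem
  set M := (a + b) * (n.choose 2 + n * n) + a * n with hM
  have key := prod_add_mul_pow_eq_sum_gaussBinom (X ^ (a + b) : R⟦X⟧) (X ^ ((a + b) * n))
    (X ^ a) (2 * n)
  have hsum : ∑ k ∈ Finset.range (2 * n + 1),
      gaussBinom (X ^ (a + b) : R⟦X⟧) (2 * n) k * (X ^ (a + b)) ^ (k.choose 2) * (X ^ a) ^ k *
        (X ^ ((a + b) * n)) ^ (2 * n - k) =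
      X ^ M * ∑ k ∈ Finset.range (2 * n + 1),
        gaussBinom (X ^ (a + b) : R⟦X⟧) (2 * n) k * X ^ thetaExp a b ((k : ℤ) - n) := by
    rw [Finset.mul_sum]
    refine Finset.sum_congr rfl fun k hk => ?_
    rw [Finset.mem_range] at hk
    have hexp : (a + b) * k.choose 2 + a * k + (a + b) * n * (2 * n - k) =
        M + thetaExp a b ((k : ℤ) - n) := by
      have hc : ∀ m : ℕ, 2 * ((m.choose 2 : ℕ) : ℤ) = m * (m - 1) := by
        intro m
        induction m with
        | zero => simp
        | succ m ih =>
          rw [Nat.choose_succ_succ' _ 1, Nat.choose_one_right]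
          push_cast
          linarith
      have h1 := two_mul_thetaExp a b ((k : ℤ) - n)
      zify [show k ≤ 2 * n by omega]
      rw [hM]
      push_cast
      have hk2 := hc k
      have hn2 := hc n
      have : (2 : ℤ) * ((a + b) * (k.choose 2 : ℕ) + a * k + (a + b) * n * (2 * n - k)) =
          2 * ((a + b) * ((n.choose 2 : ℕ) + n * n) + a * n + thetaExp a b ((k : ℤ) - n)) := by
        linear_combination (a + b : ℤ) * hk2 - (a + b : ℤ) * hn2 - h1
      linarith
    calc _ = gaussBinom (X ^ (a + b) : R⟦X⟧) (2 * n) k *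
          X ^ ((a + b) * k.choose 2 + a * k + (a + b) * n * (2 * n - k)) := by
          simp only [pow_add, pow_mul]; ring
      _ = _ := by rw [hexp, pow_add]; ring
  have hlow : ∏ i ∈ Finset.range n, (X ^ ((a + b) * n) + X ^ a * (X ^ (a + b)) ^ i : R⟦X⟧) =
      X ^ ((a + b) * n.choose 2 + a * n) *
        ∏ i ∈ Finset.range n, (1 + X ^ (b + (a + b) * i) : R⟦X⟧) := by
    have hq : ∏ i ∈ Finset.range n, (X ^ ((a + b) * i + a) : R⟦X⟧) =
        X ^ ((a + b) * n.choose 2 + a * n) := by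
      rw [Finset.prod_pow_eq_pow_sum, Finset.sum_add_distrib, ← Finset.mul_sum,
        Finset.sum_range_id, Nat.choose_two_right]
      simp [mul_comm]
    rw [← hq, ← Finset.prod_range_reflect (fun i => (1 + X ^ (b + (a + b) * i) : R⟦X⟧)),
      ← Finset.prod_mul_distrib]
    refine Finset.prod_congr rfl fun i hi => ?_
    rw [Finset.mem_range] at hi
    obtain ⟨j, rfl⟩ := Nat.exists_eq_add_of_lt hi
    rw [show i + j + 1 - 1 - i = j by omega]
    ring
  have hhigh : ∏ i ∈ Finset.range n, (X ^ ((a + b) * n) + X ^ a * (X ^ (a + b)) ^ (n + i) : R⟦X⟧) =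
      X ^ ((a + b) * (n * n)) * ∏ i ∈ Finset.range n, (1 + X ^ (a + (a + b) * i) : R⟦X⟧) := by
    have hq : ∏ i ∈ Finset.range n, (X ^ ((a + b) * n) : R⟦X⟧) = X ^ ((a + b) * (n * n)) := by
      rw [Finset.prod_const, Finset.card_range, ← pow_mul, mul_assoc]
    rw [← hq, ← Finset.prod_mul_distrib]
    refine Finset.prod_congr rfl fun i _ => ?_
    ring
  rw [hsum, two_mul n, Finset.prod_range_add, hlow, hhigh, ← two_mul n] at key
  refine X_pow_mul_cancel (k := M) ?_
  rw [← key, hM]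
  ring

lemma X_pow_dvd_qFactorial_sub {c d m : ℕ} (hc : 1 ≤ c) (h : d ≤ m) :
    (X ^ (d + 1) : R⟦X⟧) ∣ qFactorial (X ^ c) m - qFactorial (X ^ c) d := by
  induction m, h using Nat.le_induction with
  | base => simp
  | succ m hm ih =>
    rw [qFactorial_succ, show ∀ A B C : R⟦X⟧, A * (1 - B) - C = (A - C) - A * B by intros; ring]
    refine dvd_sub ih (Dvd.dvd.mul_left ?_ _)
    rw [← pow_mul]
    exact pow_dvd_pow _ (by nlinarith)

lemma isUnit_qFactorial_X_pow {c : ℕ} (hc : 1 ≤ c) (n : ℕ) :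
    IsUnit (qFactorial (X ^ c : R⟦X⟧) n) := by
  rw [isUnit_iff_constantCoeff, qFactorial, map_prod]
  simp [show c ≠ 0 by omega]

/-- Away from the two ends, `(q; q)ₙ [2 n, k]_q` agrees with `1` to high order. -/
lemma X_pow_dvd_qFactorial_mul_gaussBinom_sub_one {c d n k : ℕ} (hc : 1 ≤ c) (hn : d ≤ n)
    (hk : d ≤ k) (hk' : k + d ≤ 2 * n) :
    (X ^ (d + 1) : R⟦X⟧) ∣ qFactorial (X ^ c) n * gaussBinom (X ^ c) (2 * n) k - 1 := by
  have h := gaussBinom_mul_qFactorial (X ^ c : R⟦X⟧) (2 * n) k (2 * n - k) (by omega)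
  obtain ⟨A, hA⟩ := X_pow_dvd_qFactorial_sub R hc hn
  obtain ⟨B, hB⟩ := X_pow_dvd_qFactorial_sub R hc hk
  obtain ⟨C, hC⟩ := X_pow_dvd_qFactorial_sub R hc (show d ≤ 2 * n - k by omega)
  obtain ⟨D, hD⟩ := X_pow_dvd_qFactorial_sub R hc (show d ≤ 2 * n by omega)
  have hu := isUnit_qFactorial_X_pow R hc d
  rw [sub_eq_iff_eq_add] at hA hB hC hD
  rw [hB, hC, hD] at h
  set q := qFactorial (X ^ c : R⟦X⟧) d
  set g := gaussBinom (X ^ c : R⟦X⟧) (2 * n) k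
  rw [← (hu.pow 2).dvd_mul_left, hA]
  refine ⟨q * A + D * q + X ^ (d + 1) * A * D -
    (X ^ (d + 1) * A + q) * g * (B * q + C * q + X ^ (d + 1) * B * C) , ?_⟩
  linear_combination (X ^ (d + 1) * A + q) * h

open scoped PowerSeries.WithPiTopology

variable {R} in
/-- An infinite product of power series `1 + g n` converges if `g n` has order at least `n`. -/
lemma multipliable_one_add_of_le_order [TopologicalSpace R] {g : ℕ → R⟦X⟧}
    (hg : ∀ n : ℕ, (n : ℕ∞) ≤ (g n).order) : Multipliable (1 + g ·) := by
  refine WithPiTopology.multipliable_one_add_of_tendsto_order_atTop_nhds_top R ?_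
  exact tendsto_nhds_top_mono' ENat.tendsto_natCast_nhds_top hg

lemma le_order_X_pow {n m : ℕ} (h : n ≤ m) : (n : ℕ∞) ≤ (X ^ m : R⟦X⟧).order := by
  refine le_order _ _ fun i hi => ?_
  rw [coeff_X_pow, if_neg]
  have : i < n := by exact_mod_cast hi
  omega

lemma coeff_prod_mul_prod_mul_qFactorial {a b d n : ℕ} (ha : 1 ≤ a) (hb : 1 ≤ b)
    (hn : 2 * d ≤ n) :
    coeff d ((∏ i ∈ Finset.range n, (1 + X ^ (a + (a + b) * i) : R⟦X⟧)) *
        (∏ i ∈ Finset.range n, (1 + X ^ (b + (a + b) * i) : R⟦X⟧)) *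
          qFactorial (X ^ (a + b)) n) = coeff d (theta R a b) := by
  have hterm : ∀ k ∈ Finset.range (2 * n + 1),
      coeff d (gaussBinom (X ^ (a + b) : R⟦X⟧) (2 * n) k * X ^ thetaExp a b ((k : ℤ) - n) *
        qFactorial (X ^ (a + b)) n) = if thetaExp a b ((k : ℤ) - n) = d then 1 else 0 := by
    intro k hk
    rw [Finset.mem_range] at hk
    rw [mul_right_comm, coeff_mul_X_pow']
    split_ifs with h1 h2 h2
    · have := abs_le.1 (abs_le_thetaExp ha hb ((k : ℤ) - n))
      obtain ⟨V, hV⟩ := X_pow_dvd_qFactorial_mul_gaussBinom_sub_one R (c := a + b) (d := d)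
        (n := n) (k := k) (by omega) (by omega) (by omega) (by omega)
      rw [mul_comm, sub_eq_iff_eq_add.1 hV, map_add, coeff_X_pow_mul', if_neg (by omega), h2]
      simp
    · have := abs_le.1 (abs_le_thetaExp ha hb ((k : ℤ) - n))
      obtain ⟨V, hV⟩ := X_pow_dvd_qFactorial_mul_gaussBinom_sub_one R (c := a + b) (d := d)
        (n := n) (k := k) (by omega) (by omega) (by omega) (by omega)
      rw [mul_comm, sub_eq_iff_eq_add.1 hV, map_add, coeff_X_pow_mul', if_neg (by omega),
        coeff_one, if_neg (by omega), add_zero]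
    · omega
    · rfl
  rw [prod_mul_prod_eq_sum_gaussBinom, Finset.sum_mul, map_sum, Finset.sum_congr rfl hterm,
    Finset.sum_boole, theta, coeff_countSeries, ← Set.ncard_coe_finset]
  congr 1
  refine Set.ncard_congr (fun k _ => (k : ℤ) - n) (fun k hk => ?_) (fun k l _ _ h => ?_)
    (fun j hj => ?_)
  · simpa using (Finset.mem_filter.1 hk).2
  · simpa using h
  · rw [Set.mem_preimage, Set.mem_singleton_iff] at hj
    have := abs_le.1 (abs_le_thetaExp ha hb j)
    refine ⟨(j + n).toNat, ?_, by rw [Int.toNat_of_nonneg (by omega)]; ring⟩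
    simp only [Finset.coe_filter, Finset.mem_range]
    refine ⟨by omega, ?_⟩
    rw [Int.toNat_of_nonneg (by omega), add_sub_cancel_right, hj]

/-- The Jacobi triple product identity. -/
theorem theta_eq_tprod [TopologicalSpace R] [IsTopologicalRing R] [T2Space R] {a b : ℕ}
    (ha : 1 ≤ a) (hb : 1 ≤ b) :
    theta R a b = (∏' n : ℕ, (1 + X ^ (a + (a + b) * n))) *
      (∏' n : ℕ, (1 + X ^ (b + (a + b) * n))) * ∏' n : ℕ, (1 - X ^ ((a + b) * (n + 1))) := by
  have h1 : Multipliable fun n : ℕ => (1 + X ^ (a + (a + b) * n) : R⟦X⟧) :=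
    multipliable_one_add_of_le_order fun n => le_order_X_pow R (by nlinarith)
  have h2 : Multipliable fun n : ℕ => (1 + X ^ (b + (a + b) * n) : R⟦X⟧) :=
    multipliable_one_add_of_le_order fun n => le_order_X_pow R (by nlinarith)
  have h3 : Multipliable fun n : ℕ => (1 - X ^ ((a + b) * (n + 1)) : R⟦X⟧) := by
    simp_rw [sub_eq_add_neg]
    refine multipliable_one_add_of_le_order fun n => ?_
    rw [order_neg]
    exact le_order_X_pow R (by nlinarith)
  have hlim := (h1.hasProd.tendsto_prod_nat.mul h2.hasProd.tendsto_prod_nat).mul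
    h3.hasProd.tendsto_prod_nat
  refine tendsto_nhds_unique ?_ hlim
  rw [WithPiTopology.tendsto_iff_coeff_tendsto]
  intro d
  refine tendsto_atTop_of_eventually_const (i₀ := 2 * d) fun n hn => ?_
  rw [← coeff_prod_mul_prod_mul_qFactorial R ha hb hn]
  simp only [qFactorial, ← pow_mul]

end TripleProduct

/-! ### Infinite products over sets of exponents -/

section PartProd

open scoped PowerSeries.WithPiTopology

variable {R : Type*} [CommRing R] [TopologicalSpace R]

/-- The product of the factors `1 + c X ^ m` over all `m` satisfying `p`. -/
noncomputable def partProd (c : R) (p : ℕ → Prop) [DecidablePred p] : R⟦X⟧ :=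
  ∏' m : ℕ, if p m then 1 + C c * X ^ m else 1

lemma multipliable_partProd (c : R) (p : ℕ → Prop) [DecidablePred p] :
    Multipliable fun m : ℕ => (if p m then 1 + C c * X ^ m else 1 : R⟦X⟧) := by
  have h : ∀ m : ℕ, (if p m then 1 + C c * X ^ m else 1 : R⟦X⟧) =
      1 + if p m then C c * X ^ m else 0 := by
    intro m
    split_ifs <;> simp
  simp_rw [h]
  refine multipliable_one_add_of_le_order fun n => ?_
  split_ifs
  · exact (le_order_X_pow R le_rfl).trans (le_add_self.trans (le_order_mul _ _))
  · simp

/-- A continuous ring homomorphism between power series rings may be recognized on coefficients. -/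
lemma continuous_of_coeff_comp {R S : Type*} [Semiring R] [TopologicalSpace R] [CommRing S]
    [TopologicalSpace S] {f : R⟦X⟧ → S⟦X⟧}
    (h : ∀ d, Continuous fun A => coeff d (f A)) : Continuous f := by
  rw [continuous_iff_continuousAt]
  intro A
  rw [ContinuousAt, WithPiTopology.tendsto_iff_coeff_tendsto]
  exact fun d => (h d).continuousAt

variable [T2Space R]

omit [T2Space R] in
lemma tprod_eq_partProd (c : R) (p : ℕ → Prop) [DecidablePred p] (f : ℕ → ℕ)
    (hf : Function.Injective f) (h : ∀ m, p m ↔ ∃ n, f n = m) :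
    ∏' n, (1 + C c * X ^ f n) = partProd c p := by
  rw [partProd, ← hf.tprod_eq (f := fun m => if p m then 1 + C c * X ^ m else 1)]
  · exact tprod_congr fun n => by rw [if_pos ((h _).2 ⟨n, rfl⟩)]
  · intro m hm
    by_contra hr
    refine hm (if_neg fun hp => hr ?_)
    exact (h m).1 hp

lemma expand_partProd (c : R) (p q : ℕ → Prop) [DecidablePred p] [DecidablePred q] {k : ℕ}
    (hk : k ≠ 0) (h : ∀ m, q m ↔ ∃ n, p n ∧ k * n = m) :
    expand k hk (partProd c p) = partProd c q := by
  have hcont : Continuous (expand k hk : R⟦X⟧ →ₐ[R] R⟦X⟧) := by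
    refine continuous_of_coeff_comp fun d => ?_
    simp_rw [coeff_expand]
    split_ifs
    · exact WithPiTopology.continuous_coeff _ _
    · exact continuous_const
  have hinj : Function.Injective (k * ·) := fun a b hab => Nat.eq_of_mul_eq_mul_left
    (Nat.pos_of_ne_zero hk) hab
  rw [partProd, (multipliable_partProd c p).map_tprod _ hcont, partProd,
    ← hinj.tprod_eq (f := fun m => if q m then 1 + C c * X ^ m else 1)]
  · refine tprod_congr fun n => ?_
    have : q (k * n) ↔ p n := by simp [h, hk]
    simp only [this]
    split_ifs
    · rw [map_add, map_mul, map_pow, map_one, expand_C, expand_X, pow_mul]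
    · exact map_one _
  · intro m hm
    by_contra hr
    refine hm (if_neg fun hp => hr ?_)
    obtain ⟨n, -, rfl⟩ := (h m).1 hp
    exact ⟨n, rfl⟩

variable [IsTopologicalRing R]

lemma partProd_mul (c : R) (p q r : ℕ → Prop) [DecidablePred p] [DecidablePred q]
    [DecidablePred r] (h : ∀ m, r m ↔ p m ∨ q m) (h' : ∀ m, p m → ¬ q m) :
    partProd c p * partProd c q = partProd c r := by
  rw [partProd, partProd, partProd,
    ← (multipliable_partProd c p).tprod_mul (multipliable_partProd c q)]
  refine tprod_congr fun m => ?_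
  by_cases hp : p m
  · simp [hp, h, h' m hp]
  · simp [hp, h]

lemma rescale_neg_one_partProd (c : R) (p : ℕ → Prop) [DecidablePred p] :
    rescale (-1 : R) (partProd c p) =
      ∏' m : ℕ, if p m then 1 + C ((-1) ^ m * c) * X ^ m else 1 := by
  have hcont : Continuous (rescale (-1 : R)) := by
    refine continuous_of_coeff_comp fun d => ?_
    simp_rw [coeff_rescale]
    exact continuous_const.mul (WithPiTopology.continuous_coeff _ _)
  rw [partProd, (multipliable_partProd c p).map_tprod _ hcont]
  refine tprod_congr fun m => ?_
  split_ifs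
  · have : rescale (-1 : R) (C c) = C c := by
      ext n
      rw [coeff_rescale, coeff_C]
      split_ifs with h <;> simp [h]
    simp only [map_add, map_one, map_mul, map_pow, rescale_neg_one_X, this, map_neg]
    ring
  · simp

end PartProd

/-! ### The generating function of Schur overpartitions -/

section GenFun

open scoped PowerSeries.WithPiTopology

/-- The generating function of `t`-Schur overpartitions. -/
noncomputable def schurSeries (t : ℕ) : ℤ⟦X⟧ :=
  mk fun n => (schurOverpartitionCount t n : ℤ)

lemma schurOverpartitionCount_eq_sum (t n : ℕ) :
    (schurOverpartitionCount t n : ℤ) = ∑ p : n.Partition,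
      p.parts.toFinsupp.prod fun i _ => if i % (2 * t) ∈ schurResidues t then (2 : ℤ) else 0 := by
  have h : schurOverpartitions t n =
      (Finset.univ.filter fun p : n.Partition =>
        ∀ a ∈ p.parts, a % (2 * t) ∈ schurResidues t).sigma
          fun p => p.parts.toFinset.powerset := by
    ext ⟨p, o⟩
    simp [schurOverpartitions, overpartitions, and_comm]
  rw [schurOverpartitionCount, h, Finset.card_sigma, Finset.sum_filter, Nat.cast_sum]
  refine Finset.sum_congr rfl fun p _ => ?_
  rw [Finsupp.prod, Multiset.toFinsupp_support]
  split_ifs with hp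
  · rw [Finset.prod_congr rfl fun i hi => if_pos (hp i (Multiset.mem_toFinset.1 hi))]
    simp
  · push Not at hp
    obtain ⟨a, ha, hna⟩ := hp
    rw [Finset.prod_eq_zero (Multiset.mem_toFinset.2 ha) (if_neg hna), Nat.cast_zero]

lemma schurSeries_mul_partProd (t : ℕ) :
    schurSeries t * partProd (-1) (fun m => m % (2 * t) ∈ schurResidues t) =
      partProd 1 (fun m => m % (2 * t) ∈ schurResidues t) := by
  set p : ℕ → Prop := fun m => m % (2 * t) ∈ schurResidues t with hp
  set f : ℕ → ℕ → ℤ := fun i _ => if p i then 2 else 0 with hf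
  have h0 : ¬ p 0 := by simp [hp, schurResidues]
  have hG : schurSeries t = Nat.Partition.genFun f := by
    ext n
    rw [schurSeries, coeff_mk, Nat.Partition.coeff_genFun, schurOverpartitionCount_eq_sum]
  have hshift : ∀ c : ℤ, partProd c p =
      ∏' i : ℕ, if p (i + 1) then 1 + C c * X ^ (i + 1) else 1 := by
    intro c
    rw [partProd, ← (add_left_injective 1).tprod_eq]
    intro m hm
    rcases m with _ | m
    · exact absurd (if_neg h0) hm
    · exact ⟨m, rfl⟩
  have hmul : ∀ c : ℤ, Multipliable fun i : ℕ =>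
      (if p (i + 1) then 1 + C c * X ^ (i + 1) else 1 : ℤ⟦X⟧) := by
    intro c
    have h : ∀ m : ℕ, (if p (m + 1) then 1 + C c * X ^ (m + 1) else 1 : ℤ⟦X⟧) =
        1 + if p (m + 1) then C c * X ^ (m + 1) else 0 := by
      intro m
      split_ifs <;> simp
    simp_rw [h]
    refine multipliable_one_add_of_le_order fun n => ?_
    split_ifs
    · exact (le_order_X_pow ℤ (Nat.le_succ n)).trans (le_add_self.trans (le_order_mul _ _))
    · simp
  rw [hG, Nat.Partition.genFun_eq_tprod, hshift, hshift,
    ← (Nat.Partition.multipliable_genFun f).tprod_mul (hmul (-1))]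
  refine tprod_congr fun i => ?_
  simp only [PowerSeries.smul_eq_C_mul]
  by_cases hi : p (i + 1)
  · have hX : constantCoeff (X ^ (i + 1) : ℤ⟦X⟧) = 0 := by simp
    have h1 : ∑' j, C (f (i + 1) (j + 1)) * (X : ℤ⟦X⟧) ^ ((i + 1) * (j + 1)) =
        (2 * X ^ (i + 1)) * ∑' j, ((X : ℤ⟦X⟧) ^ (i + 1)) ^ j := by
      rw [← (WithPiTopology.summable_pow_of_constantCoeff_eq_zero hX).tsum_mul_left]
      refine tsum_congr fun j => ?_
      simp only [hf, hi, if_true, map_ofNat]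
      ring
    have h2 := WithPiTopology.tsum_pow_mul_one_sub_of_constantCoeff_eq_zero hX
    rw [h1, if_pos hi, if_pos hi]
    simp only [map_neg, map_one]
    linear_combination 2 * X ^ (i + 1) * h2
  · simp [hf, hi]

lemma mod_mem_schurResidues_nine (m : ℕ) :
    m % (2 * 9) ∈ schurResidues 9 ↔ m % 2 = 1 ∧ ¬ 9 ∣ m := by
  simp only [schurResidues, Finset.mem_erase, Finset.mem_filter, Finset.mem_range,
    Nat.odd_iff]
  omega

end GenFun

/-! ### Product identities for the theta functions -/

section Products

open scoped PowerSeries.WithPiTopology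

/-- Ramanujan's `φ(q) = ∑ q ^ (k ^ 2)`. -/
noncomputable def phi (R : Type*) [CommRing R] : R⟦X⟧ := theta R 1 1

/-- Ramanujan's `ψ(q) = ∑ q ^ (2 k ^ 2 + k)`, the series of triangular exponents. -/
noncomputable def psi (R : Type*) [CommRing R] : R⟦X⟧ := theta R 3 1

/-- The theta function `Ω(q) = ∑ q ^ (3 k ^ 2 + 2 k)`. -/
noncomputable def omegaTheta (R : Type*) [CommRing R] : R⟦X⟧ := theta R 5 1

/-- The unsigned series `∑ q ^ ((3 k ^ 2 + k) / 2)` of pentagonal exponents. -/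
noncomputable def pentTheta (R : Type*) [CommRing R] : R⟦X⟧ := theta R 2 1

/-- The substitution `q ↦ q ^ m` on power series. -/
noncomputable abbrev ex {R : Type*} [CommRing R] (m : ℕ) [NeZero m] : R⟦X⟧ →ₐ[R] R⟦X⟧ :=
  expand m (NeZero.ne m)

/-- The substitution `q ↦ -q` on power series. -/
noncomputable abbrev sgn {R : Type*} [CommRing R] : R⟦X⟧ →+* R⟦X⟧ := rescale (-1)

lemma phi_eq_partProd :
    phi ℤ = partProd 1 (· % 2 = 1) ^ 2 * partProd (-1) (fun m => m % 2 = 0 ∧ m ≠ 0) := by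
  rw [phi, theta_eq_tprod ℤ le_rfl le_rfl, sq,
    ← tprod_eq_partProd 1 (· % 2 = 1) (fun n => 1 + (1 + 1) * n) (fun a b h => by simpa using h)
      (fun m => ⟨fun h => ⟨m / 2, by omega⟩, by rintro ⟨n, rfl⟩; omega⟩),
    ← tprod_eq_partProd (-1) (fun m => m % 2 = 0 ∧ m ≠ 0) (fun n => (1 + 1) * (n + 1))
      (fun a b h => by simpa using h)
      (fun m => ⟨fun h => ⟨m / 2 - 1, by omega⟩, by rintro ⟨n, rfl⟩; omega⟩)]
  simp [sub_eq_add_neg]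

lemma expand_sgn_phi_eq_partProd :
    ex 2 (sgn (phi ℤ)) = partProd 1 (· % 2 = 1) * partProd (-1) (· % 2 = 1) *
      partProd (-1) (fun m => m % 2 = 0 ∧ m ≠ 0) := by
  have h1 : sgn (partProd (1 : ℤ) (· % 2 = 1)) = partProd (-1) (· % 2 = 1) := by
    rw [rescale_neg_one_partProd, partProd]
    refine tprod_congr fun m => ?_
    split_ifs with h
    · rw [(Nat.odd_iff.2 h).neg_one_pow, mul_one]
    · rfl
  have h2 : sgn (partProd (-1 : ℤ) (fun m => m % 2 = 0 ∧ m ≠ 0)) =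
      partProd (-1) (fun m => m % 2 = 0 ∧ m ≠ 0) := by
    rw [rescale_neg_one_partProd, partProd]
    refine tprod_congr fun m => ?_
    split_ifs with h
    · rw [(Nat.even_iff.2 h.1).neg_one_pow, one_mul]
    · rfl
  have h3 : ex 2 (partProd (-1 : ℤ) (· % 2 = 1)) = partProd (-1) (· % 4 = 2) :=
    expand_partProd _ _ _ _ fun m =>
      ⟨fun h => ⟨m / 2, by omega, by omega⟩, by rintro ⟨n, h, rfl⟩; omega⟩
  have h4 : ex 2 (partProd (-1 : ℤ) (fun m => m % 2 = 0 ∧ m ≠ 0)) =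
      partProd (-1) (fun m => m % 4 = 0 ∧ m ≠ 0) :=
    expand_partProd _ _ _ _ fun m =>
      ⟨fun h => ⟨m / 2, by omega, by omega⟩, by rintro ⟨n, h, rfl⟩; omega⟩
  have h5 : partProd (-1 : ℤ) (· % 4 = 2) * partProd (-1) (fun m => m % 4 = 0 ∧ m ≠ 0) =
      partProd (-1) (fun m => m % 2 = 0 ∧ m ≠ 0) :=
    partProd_mul _ _ _ _ (fun m => by omega) (fun m => by omega)
  -- `∏ (1 - q ^ (2 m)) = ∏ (1 - q ^ m) (1 + q ^ m)`, over the odd `m`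
  have h6 : ex 2 (partProd (-1 : ℤ) (· % 2 = 1)) =
      partProd 1 (· % 2 = 1) * partProd (-1) (· % 2 = 1) := by
    rw [h3, ← tprod_eq_partProd (-1) _ (fun n => 4 * n + 2) (fun a b h => by simpa using h)
        (fun m => ⟨fun h => ⟨m / 4, by omega⟩, by rintro ⟨n, rfl⟩; omega⟩),
      ← tprod_eq_partProd (-1) _ (fun n => 2 * n + 1) (fun a b h => by simpa using h)
        (fun m => ⟨fun h => ⟨m / 2, by omega⟩, by rintro ⟨n, rfl⟩; omega⟩),
      ← tprod_eq_partProd 1 _ (fun n => 2 * n + 1) (fun a b h => by simpa using h)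
        (fun m => ⟨fun h => ⟨m / 2, by omega⟩, by rintro ⟨n, rfl⟩; omega⟩),
      ← Multipliable.tprod_mul]
    · refine tprod_congr fun n => ?_
      simp only [map_one, map_neg]
      ring
    · simp only [map_one, one_mul]
      exact multipliable_one_add_of_le_order fun n => le_order_X_pow ℤ (by omega)
    · refine multipliable_one_add_of_le_order fun n => ?_
      simp only [map_one, map_neg, neg_mul, one_mul, order_neg]
      exact le_order_X_pow ℤ (by omega)
  rw [phi_eq_partProd, map_mul, map_mul, map_pow, map_pow, h1, h2, sq]
  nth_rewrite 1 [h6]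
  rw [h3, h4, mul_assoc, h5]

/-- The generating function of `9`-Schur overpartitions is
`φ(q) φ(-q ^ 18) / (φ(-q ^ 2) φ(q ^ 9))`. -/
lemma schurSeries_nine_mul :
    schurSeries 9 * ex 2 (sgn (phi ℤ)) * ex 9 (phi ℤ) =
      phi ℤ * ex 9 (ex 2 (sgn (phi ℤ))) := by
  have hS := schurSeries_mul_partProd 9
  have hsplit : ∀ c : ℤ, partProd c (fun m => m % (2 * 9) ∈ schurResidues 9) *
      ex 9 (partProd c (· % 2 = 1)) = partProd c (· % 2 = 1) := by
    intro c
    rw [expand_partProd c _ (fun m => m % 18 = 9) _ fun m =>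
      ⟨fun h => ⟨m / 9, by omega, by omega⟩, by rintro ⟨n, h, rfl⟩; omega⟩]
    refine partProd_mul _ _ _ _ (fun m => ?_) (fun m => ?_) <;>
    rw [mod_mem_schurResidues_nine] <;> omega
  have hp := hsplit 1
  have hm := hsplit (-1)
  rw [expand_sgn_phi_eq_partProd, phi_eq_partProd]
  simp only [map_mul, map_pow]
  set H : ℤ⟦X⟧ := partProd 1 (· % 2 = 1)
  set N : ℤ⟦X⟧ := partProd (-1) (· % 2 = 1)
  set D : ℤ⟦X⟧ := partProd (-1) (fun m => m % 2 = 0 ∧ m ≠ 0)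
  set P : ℤ⟦X⟧ := partProd 1 (fun m => m % (2 * 9) ∈ schurResidues 9)
  set M : ℤ⟦X⟧ := partProd (-1) (fun m => m % (2 * 9) ∈ schurResidues 9)
  have h : schurSeries 9 * N * ex 9 H = H * ex 9 N := by
    linear_combination ex 9 H * ex 9 N * hS - schurSeries 9 * ex 9 H * hm + ex 9 N * hp
  linear_combination D * H * ex 9 H * ex 9 D * h

section ModTwo

lemma two_eq_zero_zmod_two : (2 : (ZMod 2)⟦X⟧) = 0 := by
  rw [← map_ofNat C 2, show (OfNat.ofNat 2 : ZMod 2) = 0 from rfl, map_zero]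

/-- Over the field with two elements, squaring is the substitution `q ↦ q ^ 2`. -/
lemma expand_two_eq_sq (A : (ZMod 2)⟦X⟧) : ex 2 A = A ^ 2 := by
  have h := MvPowerSeries.map_frobenius_expand (p := 2) two_ne_zero (f := A)
  rw [ZMod.frobenius_zmod] at h
  rw [← h]
  rfl

lemma theta_two_eq_partProd {a b : ℕ} (ha : 1 ≤ a) (hb : 1 ≤ b) :
    theta (ZMod 2) a b = partProd 1 (fun m => a ≤ m ∧ m % (a + b) = a % (a + b)) *
      partProd 1 (fun m => b ≤ m ∧ m % (a + b) = b % (a + b)) *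
      partProd 1 (fun m => m ≠ 0 ∧ m % (a + b) = 0) := by
  have aux : ∀ c d : ℕ, 1 ≤ d →
      ∏' n : ℕ, (1 + X ^ (c + d * n) : (ZMod 2)⟦X⟧) =
        partProd 1 (fun m => c ≤ m ∧ m % d = c % d) := by
    intro c d hd
    rw [← tprod_eq_partProd 1 _ (fun n => c + d * n)
      (fun x y h => Nat.eq_of_mul_eq_mul_left hd (by simpa using h)) fun m => ⟨fun h => ?_, ?_⟩]
    · simp
    · obtain ⟨k, hk⟩ := (Nat.modEq_iff_dvd' h.1).1 h.2.symm
      exact ⟨k, by omega⟩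
    · rintro ⟨n, rfl⟩
      simp
  rw [theta_eq_tprod _ ha hb, aux _ _ (by omega), aux _ _ (by omega)]
  congr 1
  rw [← tprod_eq_partProd 1 _ (fun n => (a + b) * (n + 1))
      (fun x y h => by simpa using Nat.eq_of_mul_eq_mul_left (by omega) h)
      fun m => ⟨fun h => ?_, ?_⟩]
  · refine tprod_congr fun n => ?_
    rw [map_one]
    linear_combination -X ^ ((a + b) * (n + 1)) * two_eq_zero_zmod_two
  · obtain ⟨k, rfl⟩ := Nat.dvd_of_mod_eq_zero h.2
    rcases k with _ | k
    · exact absurd (mul_zero _) h.1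
    · exact ⟨k, rfl⟩
  · rintro ⟨n, rfl⟩
    refine ⟨by positivity, by simp⟩

lemma pentTheta_eq_partProd : pentTheta (ZMod 2) = partProd 1 (· ≠ 0) := by
  rw [pentTheta, theta_two_eq_partProd (by norm_num) le_rfl,
    partProd_mul _ _ _ (fun m => m % 3 ≠ 0) (fun m => by omega) (fun m => by omega),
    partProd_mul _ _ _ (· ≠ 0) (fun m => by omega) (fun m => by omega)]

lemma expand_two_pentTheta :
    ex 2 (pentTheta (ZMod 2)) = partProd 1 (fun m => m ≠ 0 ∧ m % 2 = 0) := by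
  rw [pentTheta_eq_partProd, expand_partProd _ _ (fun m => m ≠ 0 ∧ m % 2 = 0) _ fun m =>
    ⟨fun h => ⟨m / 2, by omega, by omega⟩, by rintro ⟨n, h, rfl⟩; omega⟩]

lemma pentTheta_ne_zero : pentTheta (ZMod 2) ≠ 0 := by
  intro h
  have := constantCoeff_theta (R := ZMod 2) (a := 2) (b := 1) (by norm_num) le_rfl
  rw [← pentTheta, h] at this
  simp at this

/-- Modulo two, the product of the `1 + q ^ m` over odd `m` is inverse to the pentagonal series. -/
lemma partProd_odd_mul_pentTheta :
    partProd (1 : ZMod 2) (· % 2 = 1) * pentTheta (ZMod 2) = 1 := by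
  have h : partProd (1 : ZMod 2) (· % 2 = 1) * pentTheta (ZMod 2) ^ 2 = pentTheta (ZMod 2) := by
    rw [← expand_two_eq_sq, expand_two_pentTheta, pentTheta_eq_partProd]
    exact partProd_mul _ _ _ _ (fun m => by omega) (fun m => by omega)
  refine mul_right_cancel₀ pentTheta_ne_zero ?_
  linear_combination h

/-- Modulo two, `ψ` is the cube of the pentagonal series. -/
lemma psi_two : psi (ZMod 2) = pentTheta (ZMod 2) ^ 3 := by
  have h : psi (ZMod 2) = partProd 1 (· % 2 = 1) * ex 2 (ex 2 (pentTheta (ZMod 2))) := by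
    rw [expand_two_pentTheta, expand_partProd _ _ (fun m => m ≠ 0 ∧ m % 4 = 0) _ fun m =>
      ⟨fun h => ⟨m / 2, by omega, by omega⟩, by rintro ⟨n, h, rfl⟩; omega⟩, psi,
      theta_two_eq_partProd (by norm_num) le_rfl]
    congr 1
    exact partProd_mul _ _ _ _ (fun m => by omega) (fun m => by omega)
  rw [h, expand_two_eq_sq, expand_two_eq_sq]
  linear_combination pentTheta (ZMod 2) ^ 3 * partProd_odd_mul_pentTheta

lemma omegaTheta_two_mul : omegaTheta (ZMod 2) * pentTheta (ZMod 2) = ex 3 (psi (ZMod 2)) := by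
  have h : omegaTheta (ZMod 2) * ex 3 (partProd 1 (· % 2 = 1)) =
      partProd 1 (· % 2 = 1) * ex 3 (ex 2 (pentTheta (ZMod 2))) := by
    rw [expand_two_pentTheta,
      expand_partProd _ (fun m => m ≠ 0 ∧ m % 2 = 0) (fun m => m ≠ 0 ∧ m % 6 = 0) _ fun m =>
        ⟨fun h => ⟨m / 3, by omega, by omega⟩, by rintro ⟨n, h, rfl⟩; omega⟩,
      expand_partProd _ (· % 2 = 1) (· % 6 = 3) _ fun m =>
        ⟨fun h => ⟨m / 3, by omega, by omega⟩, by rintro ⟨n, h, rfl⟩; omega⟩,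
      omegaTheta, theta_two_eq_partProd (by norm_num) le_rfl, mul_right_comm]
    congr 1
    rw [partProd_mul _ _ _ (fun m => m % 6 = 1 ∨ m % 6 = 5) (fun m => by omega)
      (fun m => by omega)]
    exact partProd_mul _ _ _ _ (fun m => by omega) (fun m => by omega)
  have h1 := partProd_odd_mul_pentTheta
  have h3 := congrArg (ex 3) h1
  rw [map_mul, map_one] at h3
  rw [expand_two_eq_sq, map_pow] at h
  rw [psi_two, map_pow]
  linear_combination pentTheta (ZMod 2) * ex 3 (pentTheta (ZMod 2)) * h +
    ex 3 (pentTheta (ZMod 2)) ^ 3 * h1 - omegaTheta (ZMod 2) * pentTheta (ZMod 2) * h3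

end ModTwo

end Products

/-! ### Dissections of the theta functions -/

section Lattice

variable (R : Type*) [CommRing R]

lemma thetaExp_one_one (k : ℤ) : (thetaExp 1 1 k : ℤ) = k ^ 2 := by
  have := two_mul_thetaExp 1 1 k
  push_cast at this
  linarith

lemma thetaExp_three_one (k : ℤ) : (thetaExp 3 1 k : ℤ) = 2 * k ^ 2 + k := by
  have := two_mul_thetaExp 3 1 k
  push_cast at this
  linarith

lemma thetaExp_five_one (k : ℤ) : (thetaExp 5 1 k : ℤ) = 3 * k ^ 2 + 2 * k := by
  have := two_mul_thetaExp 5 1 k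
  push_cast at this
  linarith

lemma two_mul_thetaExp_two_one (k : ℤ) : 2 * (thetaExp 2 1 k : ℤ) = 3 * k ^ 2 + k := by
  have := two_mul_thetaExp 2 1 k
  push_cast at this
  linarith

lemma thetaExp_two_zero (k : ℤ) : (thetaExp 2 0 k : ℤ) = k ^ 2 + k := by
  have := two_mul_thetaExp 2 0 k
  push_cast at this
  linarith

lemma finite_fiber_thetaExp_two_zero (n : ℕ) : (thetaExp 2 0 ⁻¹' {n}).Finite := by
  refine (Set.finite_Icc (-(n : ℤ) - 1) (n + 1)).subset fun k hk => ?_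
  have := thetaExp_two_zero k
  rw [Set.mem_preimage, Set.mem_singleton_iff] at hk
  rw [hk] at this
  rw [Set.mem_Icc]
  constructor <;> nlinarith

variable {R} in
lemma ex_one (A : R⟦X⟧) : ex 1 A = A := expand_one_apply A

variable {R} in
lemma ex_ex (m n : ℕ) [NeZero m] [NeZero n] (A : R⟦X⟧) :
    ex m (ex n A) = haveI : NeZero (m * n) := ⟨mul_ne_zero (NeZero.ne m) (NeZero.ne n)⟩
      ex (m * n) A := (expand_mul _ _ _ _ _).symm

lemma ex_theta (m a b : ℕ) [NeZero m] :
    ex m (theta R a b) = countSeries R (fun k => m * thetaExp a b k) :=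
  expand_countSeries _ _

lemma X_pow_mul_theta_mul_theta {a b c d : ℕ} (m n r : ℕ) [NeZero m] [NeZero n]
    (h : ∀ i, (thetaExp a b ⁻¹' {i}).Finite) (h' : ∀ i, (thetaExp c d ⁻¹' {i}).Finite) :
    X ^ r * (ex m (theta R a b) * ex n (theta R c d)) =
      countSeries R (fun p : ℤ × ℤ => m * thetaExp a b p.1 + n * thetaExp c d p.2 + r) := by
  rw [ex_theta, ex_theta, countSeries_mul (finite_fiber_mul h (NeZero.ne m))
    (finite_fiber_mul h' (NeZero.ne n)), X_pow_mul_countSeries]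

lemma finite_fiber_theta_mul_theta {a b c d : ℕ} (m n r : ℕ) [NeZero m] [NeZero n]
    (h : ∀ i, (thetaExp a b ⁻¹' {i}).Finite) (h' : ∀ i, (thetaExp c d ⁻¹' {i}).Finite) (i : ℕ) :
    ((fun p : ℤ × ℤ => m * thetaExp a b p.1 + n * thetaExp c d p.2 + r) ⁻¹' {i}).Finite := by
  have := finite_fiber_affine (finite_fiber_add (finite_fiber_mul h (NeZero.ne m))
    (finite_fiber_mul h' (NeZero.ne n))) one_ne_zero r i
  simpa only [one_mul] using this

/-- The indices `s` and `-s - 1` give the same exponent `s ^ 2 + s`. -/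
lemma theta_two_zero : theta R 2 0 = 2 * ex 2 (psi R) := by
  have hf := finite_fiber_mul (finite_fiber_thetaExp (a := 3) (b := 1) (by norm_num) le_rfl)
    two_ne_zero
  rw [two_mul, psi, ex_theta, ← countSeries_sumElim hf hf, theta]
  symm
  refine countSeries_congr (Sum.elim (fun c => 2 * c) (fun c => -2 * c - 1)) ⟨?_, ?_⟩ ?_
  · rintro (x | x) (y | y) h <;> simp only [Sum.elim_inl, Sum.elim_inr] at h <;>
      first | (exfalso; omega) | (congr 1; omega)
  · intro k
    rcases Int.even_or_odd' k with ⟨c, rfl | rfl⟩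
    · exact ⟨Sum.inl c, rfl⟩
    · exact ⟨Sum.inr (-c - 1), by simp; ring⟩
  · rintro (x | x) <;> simp only [Sum.elim_inl, Sum.elim_inr] <;> zify <;>
      rw [thetaExp_two_zero, thetaExp_three_one] <;> ring

/-- The dissection of `φ` according to the parity of the summation index. -/
lemma phi_eq_ex_four_add : phi R = ex 4 (phi R) + 2 * X * ex 8 (psi R) := by
  have h : phi R = ex 4 (phi R) + X ^ 1 * ex 4 (theta R 2 0) := by
    have hf := finite_fiber_mul (finite_fiber_thetaExp (a := 1) (b := 1) le_rfl le_rfl)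
      four_ne_zero
    have hf' := finite_fiber_affine finite_fiber_thetaExp_two_zero four_ne_zero 1
    rw [phi, ex_theta, ex_theta, X_pow_mul_countSeries, ← countSeries_sumElim hf hf', theta]
    symm
    refine countSeries_congr (Sum.elim (fun c => 2 * c) (fun c => 2 * c + 1)) ⟨?_, ?_⟩ ?_
    · rintro (x | x) (y | y) h <;> simp only [Sum.elim_inl, Sum.elim_inr] at h <;>
        first | (exfalso; omega) | (congr 1; omega)
    · intro k
      rcases Int.even_or_odd' k with ⟨c, rfl | rfl⟩
      · exact ⟨Sum.inl c, rfl⟩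
      · exact ⟨Sum.inr c, rfl⟩
    · rintro (x | x) <;> simp only [Sum.elim_inl, Sum.elim_inr] <;> zify <;>
        simp only [thetaExp_two_zero, thetaExp_one_one] <;> ring
  rw [theta_two_zero, map_mul, map_ofNat, ex_ex] at h
  linear_combination h

/-- The dissection of `φ` according to the residue modulo three of the summation index. -/
lemma phi_eq_ex_nine_add : phi R = ex 9 (phi R) + 2 * X * ex 3 (omegaTheta R) := by
  have hf := finite_fiber_mul (finite_fiber_thetaExp (a := 1) (b := 1) le_rfl le_rfl)
    (show 9 ≠ 0 by norm_num)
  have hf' := finite_fiber_affine (finite_fiber_thetaExp (a := 5) (b := 1) (by norm_num) le_rfl)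
    three_ne_zero 1
  have h : phi R = ex 9 (phi R) +
      (X ^ 1 * ex 3 (omegaTheta R) + X ^ 1 * ex 3 (omegaTheta R)) := by
    rw [phi, omegaTheta, ex_theta, ex_theta, X_pow_mul_countSeries, ← countSeries_sumElim hf' hf',
      ← countSeries_sumElim hf, theta]
    · symm
      refine countSeries_congr (Sum.elim (fun c => 3 * c)
        (Sum.elim (fun c => 3 * c + 1) (fun c => -3 * c - 1))) ⟨?_, ?_⟩ ?_
      · rintro (x | x | x) (y | y | y) h <;> simp only [Sum.elim_inl, Sum.elim_inr] at h <;>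
          first | (exfalso; omega) | (congr 2; omega)
      · intro k
        have : k % 3 = 0 ∨ k % 3 = 1 ∨ k % 3 = 2 := by omega
        rcases this with h | h | h
        · exact ⟨Sum.inl (k / 3), by simp; omega⟩
        · exact ⟨Sum.inr (Sum.inl (k / 3)), by simp; omega⟩
        · exact ⟨Sum.inr (Sum.inr (-(k / 3) - 1)), by simp; omega⟩
      · rintro (x | x | x) <;> simp only [Sum.elim_inl, Sum.elim_inr] <;> zify <;>
          simp only [thetaExp_one_one, thetaExp_five_one] <;> ring
    · exact finite_fiber_sumElim hf' hf'
  linear_combination h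

/-- The dissection of `Ω` according to the parity of the summation index. -/
lemma omegaTheta_eq_ex_eight_add :
    omegaTheta R = ex 8 (pentTheta R) + X * ex 4 (omegaTheta R) := by
  have h : omegaTheta R = ex 8 (pentTheta R) + X ^ 1 * ex 4 (omegaTheta R) := by
    have hf := finite_fiber_mul (finite_fiber_thetaExp (a := 2) (b := 1) (by norm_num) le_rfl)
      (show 8 ≠ 0 by norm_num)
    have hf' := finite_fiber_affine (finite_fiber_thetaExp (a := 5) (b := 1) (by norm_num) le_rfl)
      four_ne_zero 1
    rw [omegaTheta, pentTheta, ex_theta, ex_theta, X_pow_mul_countSeries,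
      ← countSeries_sumElim hf hf', theta]
    symm
    refine countSeries_congr (Sum.elim (fun c => 2 * c) (fun c => -2 * c - 1)) ⟨?_, ?_⟩ ?_
    · rintro (x | x) (y | y) h <;> simp only [Sum.elim_inl, Sum.elim_inr] at h <;>
        first | (exfalso; omega) | (congr 1; omega)
    · intro k
      rcases Int.even_or_odd' k with ⟨c, rfl | rfl⟩
      · exact ⟨Sum.inl c, rfl⟩
      · exact ⟨Sum.inr (-c - 1), by simp; ring⟩
    · rintro (x | x) <;> simp only [Sum.elim_inl, Sum.elim_inr] <;> zify <;>
        simp only [thetaExp_five_one]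
      · linear_combination -4 * two_mul_thetaExp_two_one x
      · ring
  linear_combination h

/-! ### Products of theta functions and the ring `ℤ[√-2]` -/

/-- The series `Ω(q) f(q ^ 4, q ^ 8)` is fixed by the section `3 n + 1`. Its exponents are the `e`
with `3 (2 e + 1) = x ^ 2 + 2 y ^ 2`, where `x ≡ 1 (mod 6)` and `y ≡ 1 (mod 3)`, and multiplication
of `x + y √-2` by `-(1 + √-2)` is a bijection between the exponents `e` and `3 e + 1`. -/
lemma progSection_three_one_omegaTheta_mul :
    progSection 3 1 (omegaTheta R * ex 4 (pentTheta R)) = omegaTheta R * ex 4 (pentTheta R) := by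
  have hser := X_pow_mul_theta_mul_theta R 1 4 0
    (finite_fiber_thetaExp (a := 5) (b := 1) (by norm_num) le_rfl)
    (finite_fiber_thetaExp (a := 2) (b := 1) (by norm_num) le_rfl)
  rw [ex_one, pow_zero, one_mul] at hser
  rw [omegaTheta, pentTheta, hser]
  refine progSection_countSeries three_ne_zero
    (fun p => (-2 * p.2 - p.1 - 1, p.1 - p.2)) ?_ ?_ ?_
  · rintro ⟨k, l⟩ ⟨k', l'⟩ h
    simp only [Prod.mk.injEq] at h ⊢
    omega
  · rintro ⟨k, l⟩
    zify
    simp only [thetaExp_five_one]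
    linear_combination 2 * two_mul_thetaExp_two_one (k - l) - 6 * two_mul_thetaExp_two_one l
  · rintro ⟨k, l⟩ m h
    zify at h
    simp only [thetaExp_five_one] at h
    have h2 := two_mul_thetaExp_two_one l
    have h3 : 3 * (k ^ 2 + 2 * l ^ 2) + 2 * (k + l) = 3 * m + 1 := by linarith
    generalize k ^ 2 + 2 * l ^ 2 = w at h3
    refine ⟨(l - (k + l + 1) / 3, -((k + l + 1) / 3)), ?_⟩
    simp only [Prod.mk.injEq]
    omega

/-- In the setting of `progSection_three_one_omegaTheta_mul`, division by `1 + √-2` turns the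
exponents in the class `3 n + 2` into solutions of `6 n + 5 = u ^ 2 + 2 v ^ 2` with `3 ∣ u`; the
sign of `u` makes each of them occur twice. -/
lemma progSection_three_two_omegaTheta_mul :
    progSection 3 2 (omegaTheta R * ex 4 (pentTheta R)) =
      2 * X * ex 12 (psi R) * omegaTheta R := by
  have hser := X_pow_mul_theta_mul_theta R 1 4 0
    (finite_fiber_thetaExp (a := 5) (b := 1) (by norm_num) le_rfl)
    (finite_fiber_thetaExp (a := 2) (b := 1) (by norm_num) le_rfl)
  have hser' := X_pow_mul_theta_mul_theta R 6 1 1 finite_fiber_thetaExp_two_zero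
    (finite_fiber_thetaExp (a := 5) (b := 1) (by norm_num) le_rfl)
  rw [ex_one, pow_zero, one_mul] at hser
  rw [ex_one, theta_two_zero, map_mul, map_ofNat, ex_ex, ← omegaTheta] at hser'
  trans X ^ 1 * (2 * ex 12 (psi R) * omegaTheta R)
  swap
  · ring
  rw [hser', omegaTheta, pentTheta, hser]
  refine progSection_countSeries three_ne_zero
    (fun p => (2 * p.1 + p.2 + 1, p.1 - p.2)) ?_ ?_ ?_
  · rintro ⟨k, l⟩ ⟨k', l'⟩ h
    simp only [Prod.mk.injEq] at h ⊢
    omega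
  · rintro ⟨s, c⟩
    zify
    simp only [thetaExp_five_one, thetaExp_two_zero]
    linear_combination 2 * two_mul_thetaExp_two_one (s - c)
  · rintro ⟨k, l⟩ m h
    zify at h
    simp only [thetaExp_five_one] at h
    have h2 := two_mul_thetaExp_two_one l
    have h3 : 3 * (k ^ 2 + 2 * l ^ 2) + 2 * (k + l) = 3 * m + 2 := by linarith
    generalize k ^ 2 + 2 * l ^ 2 = w at h3
    refine ⟨((k + l - 1) / 3, (k + l - 1) / 3 - l), ?_⟩
    simp only [Prod.mk.injEq]
    omega

/-- The series `Ω(q) Ω(q ^ 2)` is fixed by the section `3 n + 2`: its exponents are the `e` with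
`3 (e + 1) = x ^ 2 + 2 y ^ 2`, where `x ≡ y ≡ 1 (mod 3)`. -/
lemma progSection_three_two_omegaTheta_mul_omegaTheta :
    progSection 3 2 (omegaTheta R * ex 2 (omegaTheta R)) =
      omegaTheta R * ex 2 (omegaTheta R) := by
  have hser := X_pow_mul_theta_mul_theta R 1 2 0
    (finite_fiber_thetaExp (a := 5) (b := 1) (by norm_num) le_rfl)
    (finite_fiber_thetaExp (a := 5) (b := 1) (by norm_num) le_rfl)
  rw [ex_one, pow_zero, one_mul] at hser
  rw [omegaTheta, hser]
  refine progSection_countSeries three_ne_zero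
    (fun p => (2 * p.2 - p.1, -p.1 - p.2 - 1)) ?_ ?_ ?_
  · rintro ⟨k, l⟩ ⟨k', l'⟩ h
    simp only [Prod.mk.injEq] at h ⊢
    omega
  · rintro ⟨k, l⟩
    zify
    simp only [thetaExp_five_one]
    ring
  · rintro ⟨k, l⟩ m h
    zify at h
    simp only [thetaExp_five_one] at h
    have h3 : 3 * (k ^ 2 + 2 * l ^ 2) + 2 * k + 4 * l = 3 * m + 2 := by linarith
    generalize k ^ 2 + 2 * l ^ 2 = w at h3
    refine ⟨(2 * ((k - l - 1) / 3) - k, (k - l - 1) / 3), ?_⟩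
    simp only [Prod.mk.injEq]
    omega

/-- The class `3 n` of the exponents of `Ω(q) Ω(q ^ 2)`: division by `1 + √-2` leads to the
solutions of `3 n + 1 = u ^ 2 + 2 v ^ 2` with `3 ∣ v`. -/
lemma progSection_three_zero_omegaTheta_mul_omegaTheta :
    progSection 3 0 (omegaTheta R * ex 2 (omegaTheta R)) = omegaTheta R * ex 6 (phi R) := by
  have hser := X_pow_mul_theta_mul_theta R 1 2 0
    (finite_fiber_thetaExp (a := 5) (b := 1) (by norm_num) le_rfl)
    (finite_fiber_thetaExp (a := 5) (b := 1) (by norm_num) le_rfl)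
  have hser' := X_pow_mul_theta_mul_theta R 1 6 0
    (finite_fiber_thetaExp (a := 5) (b := 1) (by norm_num) le_rfl)
    (finite_fiber_thetaExp (a := 1) (b := 1) le_rfl le_rfl)
  rw [ex_one, pow_zero, one_mul] at hser hser'
  rw [omegaTheta, phi, hser, hser']
  refine progSection_countSeries three_ne_zero
    (fun p => (p.1 - 2 * p.2, p.1 + p.2)) ?_ ?_ ?_
  · rintro ⟨k, l⟩ ⟨k', l'⟩ h
    simp only [Prod.mk.injEq] at h ⊢
    omega
  · rintro ⟨k, l⟩
    zify
    simp only [thetaExp_five_one, thetaExp_one_one]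
    ring
  · rintro ⟨k, l⟩ m h
    zify at h
    simp only [thetaExp_five_one] at h
    have h3 : 3 * (k ^ 2 + 2 * l ^ 2) + 2 * k + 4 * l = 3 * m := by linarith
    generalize k ^ 2 + 2 * l ^ 2 = w at h3
    refine ⟨(k + 2 * ((l - k) / 3), (l - k) / 3), ?_⟩
    simp only [Prod.mk.injEq]
    omega

/-- The dissection of `ψ(q) ψ(q ^ 3)`, the indices `(i, j)` being separated by the residue of
`i - j` modulo four. -/
lemma psi_mul_ex_three_psi :
    psi R * ex 3 (psi R) =
      ex 4 (psi R) * ex 24 (phi R) + X * (ex 12 (psi R) * ex 8 (phi R)) +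
      2 * (X ^ 6 * (ex 4 (psi R) * ex 48 (psi R)) + X ^ 3 * (ex 12 (psi R) * ex 16 (psi R))) := by
  have f3 := finite_fiber_thetaExp (a := 3) (b := 1) (by norm_num) le_rfl
  have f1 := finite_fiber_thetaExp (a := 1) (b := 1) le_rfl le_rfl
  have f2 := finite_fiber_thetaExp_two_zero
  have h := X_pow_mul_theta_mul_theta R 1 3 0 f3 f3
  have h1 := X_pow_mul_theta_mul_theta R 4 24 0 f3 f1
  have h2 := X_pow_mul_theta_mul_theta R 12 8 1 f3 f1
  have h3 := X_pow_mul_theta_mul_theta R 4 24 6 f3 f2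
  have h4 := X_pow_mul_theta_mul_theta R 12 8 3 f3 f2
  have e1 := finite_fiber_theta_mul_theta 4 24 0 f3 f1
  have e2 := finite_fiber_theta_mul_theta 12 8 1 f3 f1
  have e3 := finite_fiber_theta_mul_theta 4 24 6 f3 f2
  have e4 := finite_fiber_theta_mul_theta 12 8 3 f3 f2
  have key : X ^ 0 * (ex 1 (psi R) * ex 3 (psi R)) =
      (X ^ 0 * (ex 4 (psi R) * ex 24 (phi R)) + X ^ 1 * (ex 12 (psi R) * ex 8 (phi R))) +
      (X ^ 6 * (ex 4 (psi R) * ex 24 (theta R 2 0)) +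
        X ^ 3 * (ex 12 (psi R) * ex 8 (theta R 2 0))) := by
    rw [psi, phi, h, h1, h2, h3, h4, ← countSeries_sumElim e1 e2, ← countSeries_sumElim e3 e4,
      ← countSeries_sumElim (finite_fiber_sumElim e1 e2) (finite_fiber_sumElim e3 e4)]
    symm
    refine countSeries_congr (Sum.elim
      (Sum.elim (fun p => (p.1 + 3 * p.2, p.1 - p.2)) (fun p => (p.2 - 3 * p.1 - 1, p.2 + p.1)))
      (Sum.elim (fun p => (-p.1 + 3 * p.2 + 1, -p.1 - p.2 - 1))
        (fun p => (p.2 + 3 * p.1 + 1, p.2 - p.1)))) ⟨?_, ?_⟩ ?_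
    · rintro ((⟨a, b⟩ | ⟨a, b⟩) | (⟨a, b⟩ | ⟨a, b⟩)) ((⟨c, d⟩ | ⟨c, d⟩) | (⟨c, d⟩ | ⟨c, d⟩)) h <;>
        simp only [Sum.elim_inl, Sum.elim_inr, Prod.mk.injEq] at h <;>
        first
          | (exfalso; omega)
          | (obtain ⟨rfl, rfl⟩ : a = c ∧ b = d := by omega
             rfl)
    · rintro ⟨i, j⟩
      have : (i - j) % 4 = 0 ∨ (i - j) % 4 = 1 ∨ (i - j) % 4 = 2 ∨ (i - j) % 4 = 3 := by omega
      rcases this with h | h | h | h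
      · exact ⟨Sum.inl (Sum.inl (j + (i - j) / 4, (i - j) / 4)), by simp; omega⟩
      · exact ⟨Sum.inr (Sum.inr ((i - j) / 4, j + (i - j) / 4)), by simp; omega⟩
      · exact ⟨Sum.inr (Sum.inl (-j - (i - j) / 4 - 1, (i - j) / 4)), by simp; omega⟩
      · exact ⟨Sum.inl (Sum.inr (-((i - j) / 4) - 1, j + (i - j) / 4 + 1)), by simp; omega⟩
    · rintro ((⟨a, b⟩ | ⟨a, b⟩) | (⟨a, b⟩ | ⟨a, b⟩)) <;>
        simp only [Sum.elim_inl, Sum.elim_inr] <;> zify <;>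
        simp only [thetaExp_three_one, thetaExp_one_one, thetaExp_two_zero] <;> ring
  rw [theta_two_zero, map_mul, map_mul, map_ofNat, map_ofNat, ex_ex, ex_ex, ex_one] at key
  linear_combination key

end Lattice

/-! ### Reduction modulo two and four -/

section Reduction

lemma exists_eq_mul_of_map_castRingHom_eq_zero {k : ℕ} {A : ℤ⟦X⟧}
    (h : map (Int.castRingHom (ZMod k)) A = 0) :
    ∃ H : ℤ⟦X⟧, A = (k : ℤ⟦X⟧) * H := by
  refine ⟨mk fun n => coeff n A / k, ?_⟩
  ext n
  have hn : ((coeff n A : ℤ) : ZMod k) = 0 := by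
    have := congrArg (coeff n) h
    simpa using this
  rw [ZMod.intCast_zmod_eq_zero_iff_dvd] at hn
  rw [show (k : ℤ⟦X⟧) = C (k : ℤ) by simp, coeff_C_mul, coeff_mk, Int.mul_ediv_cancel' hn]

variable {R S : Type*} [CommRing R] [CommRing S]

lemma map_sgn (f : R →+* S) (A : R⟦X⟧) : map f (sgn A) = sgn (map f A) := by
  ext n
  simp [coeff_rescale]

lemma map_phi (f : R →+* S) : map f (phi R) = phi S := map_countSeries _ _

lemma map_psi (f : R →+* S) : map f (psi R) = psi S := map_countSeries _ _

lemma map_omegaTheta (f : R →+* S) : map f (omegaTheta R) = omegaTheta S := map_countSeries _ _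

lemma map_pentTheta (f : R →+* S) : map f (pentTheta R) = pentTheta S := map_countSeries _ _

lemma expand_four_eq_pow (A : (ZMod 2)⟦X⟧) : ex 4 A = A ^ 4 := by
  rw [show ex 4 A = ex 2 (ex 2 A) from (ex_ex 2 2 A).symm, expand_two_eq_sq, expand_two_eq_sq]
  ring

lemma phi_two : phi (ZMod 2) = 1 := by
  have h := phi_eq_ex_four_add (ZMod 2)
  rw [expand_four_eq_pow, two_eq_zero_zmod_two, zero_mul, zero_mul, add_zero] at h
  have hc : constantCoeff (phi (ZMod 2)) = 1 := constantCoeff_theta le_rfl le_rfl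
  have h0 : phi (ZMod 2) * (phi (ZMod 2) ^ 2 + phi (ZMod 2) + 1) ≠ 0 := by
    intro h0
    have := congrArg constantCoeff h0
    simp only [map_mul, map_add, map_pow, hc, map_one, map_zero] at this
    exact absurd this (by decide)
  have h1 : (phi (ZMod 2) * (phi (ZMod 2) ^ 2 + phi (ZMod 2) + 1)) * (phi (ZMod 2) - 1) = 0 := by
    linear_combination -h
  exact sub_eq_zero.1 ((mul_eq_zero.1 h1).resolve_left h0)

lemma two_mul_cancel {A B : ℤ⟦X⟧} (h : 2 * A = 2 * B) : A = B := by
  ext n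
  have := congrArg (coeff n) h
  rw [two_mul, two_mul, map_add, map_add] at this
  omega

/-- The series `(φ(q) - 1) / 2 = ∑ q ^ (k ^ 2)`, summed over the positive integers `k`; it is
obtained as a witness of the divisibility of `φ(q) - 1` by two. -/
noncomputable def halfPhi : ℤ⟦X⟧ :=
  (exists_eq_mul_of_map_castRingHom_eq_zero (k := 2) (A := phi ℤ - 1) (by
    rw [map_sub, map_phi, phi_two, map_one, sub_self])).choose

lemma phi_eq_one_add : phi ℤ = 1 + 2 * halfPhi := by
  have := (exists_eq_mul_of_map_castRingHom_eq_zero (k := 2) (A := phi ℤ - 1) (by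
    rw [map_sub, map_phi, phi_two, map_one, sub_self])).choose_spec
  rw [← halfPhi] at this
  push_cast at this
  linear_combination this

lemma constantCoeff_halfPhi : constantCoeff halfPhi = 0 := by
  have h : constantCoeff (phi ℤ) = 1 := constantCoeff_theta le_rfl le_rfl
  have h2 : constantCoeff (2 : ℤ⟦X⟧) = 2 := map_ofNat _ 2
  rw [phi_eq_one_add, map_add, map_mul, h2, map_one] at h
  omega

lemma halfPhi_eq : halfPhi = ex 4 halfPhi + X * ex 8 (psi ℤ) := by
  have h := phi_eq_ex_four_add ℤ
  rw [phi_eq_one_add, map_add, map_mul, map_ofNat (ex 4 : ℤ⟦X⟧ →ₐ[ℤ] ℤ⟦X⟧) 2, map_one] at h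
  refine two_mul_cancel ?_
  linear_combination h

/-- The sum of `halfPhi` at `q`, `q ^ 2`, `q ^ 3` and `q ^ 6`. -/
noncomputable def halfPhiSum : ℤ⟦X⟧ :=
  halfPhi + ex 2 halfPhi + ex 3 halfPhi + ex 6 halfPhi

lemma ex_eight_eq_pow (A : (ZMod 2)⟦X⟧) : ex 8 A = A ^ 8 := by
  rw [show ex 8 A = ex 4 (ex 2 A) from (ex_ex 4 2 A).symm, expand_four_eq_pow, expand_two_eq_sq]
  ring

/-- Modulo two, `P = ψ(q)` and `R = ψ(q ^ 3)` satisfy `P R = P ^ 4 + q R ^ 4`. -/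
lemma psi_mul_ex_three_psi_two :
    psi (ZMod 2) * ex 3 (psi (ZMod 2)) = psi (ZMod 2) ^ 4 + X * ex 3 (psi (ZMod 2)) ^ 4 := by
  have h := psi_mul_ex_three_psi (ZMod 2)
  rw [phi_two, map_one, map_one, two_eq_zero_zmod_two, expand_four_eq_pow,
    show ex 12 (psi (ZMod 2)) = ex 4 (ex 3 (psi (ZMod 2))) from (ex_ex 4 3 _).symm,
    expand_four_eq_pow] at h
  linear_combination h

/-- Modulo two, `halfPhiSum` is `q R ^ 3 / P`, where `P = ψ(q)` and `R = ψ(q ^ 3)`: the two series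
solve the same Artin–Schreier equation and both vanish at the origin. -/
lemma halfPhiSum_mul_psi_two :
    map (Int.castRingHom (ZMod 2)) halfPhiSum * psi (ZMod 2) = X * ex 3 (psi (ZMod 2)) ^ 3 := by
  set t := map (Int.castRingHom (ZMod 2)) halfPhi with ht
  set P := psi (ZMod 2)
  set R := ex 3 P with hR
  have h2 := two_eq_zero_zmod_two
  have hsum : map (Int.castRingHom (ZMod 2)) halfPhiSum = t + t ^ 2 + ex 3 t + (ex 3 t) ^ 2 := by
    rw [halfPhiSum, map_add, map_add, map_add, map_expand, map_expand, map_expand, ← ht]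
    change t + ex 2 t + ex 3 t + ex 6 t = _
    rw [expand_two_eq_sq, show ex 6 t = ex 2 (ex 3 t) from (ex_ex 2 3 t).symm, expand_two_eq_sq]
  have hD : P * R = P ^ 4 + X * R ^ 4 := psi_mul_ex_three_psi_two
  have ht1 : t = t ^ 4 + X * P ^ 8 := by
    have := congrArg (map (Int.castRingHom (ZMod 2))) halfPhi_eq
    rw [map_add, map_mul, map_expand, map_expand, map_X, map_psi, ← ht] at this
    change t = ex 4 t + X * ex 8 P at this
    rwa [expand_four_eq_pow, ex_eight_eq_pow] at this
  have ht3 : ex 3 t = (ex 3 t) ^ 4 + X ^ 3 * R ^ 8 := by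
    have := congrArg (ex 3) ht1
    rw [map_add, map_mul, map_pow, map_pow] at this
    rw [hR]
    conv_lhs => rw [this]
    simp
  rw [hsum]
  set s := ex 3 t with hs
  set U := (t + t ^ 2 + s + s ^ 2) * P + X * R ^ 3 with hU
  have hprod : U * (U + P) = 0 := by
    -- both sides are `(t + t ^ 4) + (s + s ^ 4)` modulo two
    have hA : (t + t ^ 2 + s + s ^ 2) + (t + t ^ 2 + s + s ^ 2) ^ 2 =
        X * P ^ 8 + X ^ 3 * R ^ 8 := by
      linear_combination ht1 + ht3 + (t ^ 2 + t ^ 3 + s ^ 2 + s ^ 3 + t ^ 4 + s ^ 4 +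
        t * s + t * s ^ 2 + t ^ 2 * s + t ^ 2 * s ^ 2) * h2
    have hB : P ^ 8 + X ^ 2 * R ^ 8 = P ^ 2 * R ^ 2 := by
      linear_combination -(P * R + P ^ 4 + X * R ^ 4) * hD - (P ^ 4 * X * R ^ 4) * h2
    rw [hU]
    linear_combination P ^ 2 * hA + X * P ^ 2 * hB - X * R ^ 2 * hD +
      (X * R ^ 3 * P * (t + t ^ 2 + s + s ^ 2) + X * R ^ 3 * P) * h2
  have hne : U + P ≠ 0 := by
    intro h
    have ht0 : constantCoeff t = 0 := by
      rw [ht, ← coeff_zero_eq_constantCoeff_apply, coeff_map, coeff_zero_eq_constantCoeff_apply,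
        constantCoeff_halfPhi, map_zero]
    have hP0 : constantCoeff P = 1 := constantCoeff_theta (by norm_num) le_rfl
    have hs0 : constantCoeff s = 0 := by rw [hs, constantCoeff_expand, ht0]
    have := congrArg constantCoeff h
    simp [hU, ht0, hP0, hs0] at this
  have := (mul_eq_zero.1 hprod).resolve_right hne
  linear_combination this - X * R ^ 3 * h2

/-- The congruence modulo two behind `S̄₉(18 n + 9) ≡ -S̄₉(6 n + 3) (mod 16)`. -/
lemma exists_halfPhiSum_mul_eq :
    ∃ H : ℤ⟦X⟧, halfPhiSum * (omegaTheta ℤ * ex 4 (pentTheta ℤ)) =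
      omegaTheta ℤ * ex 2 (omegaTheta ℤ) * (X * ex 4 (psi ℤ) + X ^ 2 * ex 12 (psi ℤ)) + 2 * H := by
  have h : map (Int.castRingHom (ZMod 2)) (halfPhiSum * (omegaTheta ℤ * ex 4 (pentTheta ℤ)) -
      omegaTheta ℤ * ex 2 (omegaTheta ℤ) * (X * ex 4 (psi ℤ) + X ^ 2 * ex 12 (psi ℤ))) = 0 := by
    simp only [map_sub, map_mul, map_add, map_pow, map_expand, map_X, map_psi, map_omegaTheta,
      map_pentTheta]
    change _ * (_ * ex 4 _) - _ * ex 2 _ * (_ * ex 4 _ + _ * ex 12 _) = 0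
    rw [expand_four_eq_pow, expand_four_eq_pow, expand_two_eq_sq,
      show ex 12 (psi (ZMod 2)) = ex 4 (ex 3 (psi (ZMod 2))) from (ex_ex 4 3 _).symm,
      expand_four_eq_pow]
    have h1 := halfPhiSum_mul_psi_two
    have h2 := psi_mul_ex_three_psi_two
    have h3 := psi_two
    have h4 := omegaTheta_two_mul
    set E := pentTheta (ZMod 2)
    set P := psi (ZMod 2)
    set R := ex 3 P
    set W := omegaTheta (ZMod 2)
    set T := map (Int.castRingHom (ZMod 2)) halfPhiSum
    refine (mul_eq_zero.1 (?_ : (_ : (ZMod 2)⟦X⟧) * E ^ 2 = 0)).resolve_right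
      (pow_ne_zero 2 pentTheta_ne_zero)
    linear_combination -W * T * (E ^ 3 + P) * h3 + W * P * h1 + W * X * R ^ 2 * h2 -
      W * (X * P ^ 4 + X ^ 2 * R ^ 4) * (W * E + R) * h4
  obtain ⟨H, hH⟩ := exists_eq_mul_of_map_castRingHom_eq_zero h
  refine ⟨H, ?_⟩
  push_cast at hH
  linear_combination hH

/-- The congruence modulo two behind `S̄₉(18 n + 15) ≡ S̄₉(6 n + 5) (mod 16)`. -/
lemma exists_omegaTheta_mul_eq :
    ∃ H : ℤ⟦X⟧, omegaTheta ℤ * (ex 4 (psi ℤ) + X * ex 12 (psi ℤ)) =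
      omegaTheta ℤ ^ 2 * ex 4 (pentTheta ℤ) + 2 * H := by
  have h : map (Int.castRingHom (ZMod 2)) (omegaTheta ℤ * (ex 4 (psi ℤ) + X * ex 12 (psi ℤ)) -
      omegaTheta ℤ ^ 2 * ex 4 (pentTheta ℤ)) = 0 := by
    simp only [map_sub, map_mul, map_add, map_pow, map_expand, map_X, map_psi, map_omegaTheta,
      map_pentTheta]
    change _ * (ex 4 _ + _ * ex 12 _) - _ * ex 4 _ = 0
    rw [expand_four_eq_pow, expand_four_eq_pow,
      show ex 12 (psi (ZMod 2)) = ex 4 (ex 3 (psi (ZMod 2))) from (ex_ex 4 3 _).symm,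
      expand_four_eq_pow]
    linear_combination -omegaTheta (ZMod 2) * psi_mul_ex_three_psi_two +
      omegaTheta (ZMod 2) * ex 3 (psi (ZMod 2)) * psi_two -
      omegaTheta (ZMod 2) * pentTheta (ZMod 2) ^ 3 * omegaTheta_two_mul
  obtain ⟨H, hH⟩ := exists_eq_mul_of_map_castRingHom_eq_zero h
  refine ⟨H, ?_⟩
  push_cast at hH
  linear_combination hH

end Reduction

/-! ### Sections of the generating function modulo six -/

section Sections

/-- The even part of `Ω(q) φ(-q ^ 3)`, as a series in `q ^ 2`. -/
noncomputable def evenPart (R : Type*) [CommRing R] : R⟦X⟧ :=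
  ex 4 (pentTheta R) * ex 6 (phi R) - 2 * X ^ 2 * (ex 2 (omegaTheta R) * ex 12 (psi R))

lemma sgn_ex_two_mul {R : Type*} [CommRing R] (m : ℕ) [NeZero m] (A : R⟦X⟧) :
    haveI : NeZero (2 * m) := ⟨mul_ne_zero two_ne_zero (NeZero.ne m)⟩
    sgn (ex (2 * m) A) = ex (2 * m) A := by
  rw [← ex_ex]
  exact rescale_neg_one_expand_two _

lemma sgn_ex_three {R : Type*} [CommRing R] (A : R⟦X⟧) : sgn (ex 3 A) = ex 3 (sgn A) :=
  rescale_neg_one_expand_of_odd _ (by decide) A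

lemma sgn_X {R : Type*} [CommRing R] : sgn (X : R⟦X⟧) = -X := rescale_neg_one_X

lemma ex_X {R : Type*} [CommRing R] (m : ℕ) [NeZero m] : ex m (X : R⟦X⟧) = X ^ m := expand_X _ _

lemma omegaTheta_mul_sgn_phi :
    ∃ L : ℤ⟦X⟧, omegaTheta ℤ * sgn (ex 3 (phi ℤ)) = ex 2 (evenPart ℤ) + X * ex 2 L := by
  have h1 := omegaTheta_eq_ex_eight_add ℤ
  have h2 := congrArg sgn (congrArg (ex 3) (phi_eq_ex_four_add ℤ))
  have e1 : ex 3 (ex 4 (phi ℤ)) = ex (2 * 6) (phi ℤ) := ex_ex 3 4 _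
  have e2 : ex 3 (ex 8 (psi ℤ)) = ex (2 * 12) (psi ℤ) := ex_ex 3 8 _
  rw [map_add, map_mul, map_mul, map_ofNat (ex 3 : ℤ⟦X⟧ →ₐ[ℤ] ℤ⟦X⟧) 2, ex_X, e1, e2, map_add,
    map_mul, map_mul, map_ofNat (sgn : ℤ⟦X⟧ →+* ℤ⟦X⟧) 2, map_pow, sgn_X, sgn_ex_two_mul 6,
    sgn_ex_two_mul 12] at h2
  refine ⟨ex 2 (omegaTheta ℤ) * ex 6 (phi ℤ) - 2 * X * (ex 4 (pentTheta ℤ) * ex 12 (psi ℤ)), ?_⟩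
  have f1 : ex 2 (ex 4 (pentTheta ℤ)) = ex 8 (pentTheta ℤ) := ex_ex 2 4 _
  have f2 : ex 2 (ex 6 (phi ℤ)) = ex (2 * 6) (phi ℤ) := ex_ex 2 6 _
  have f3 : ex 2 (ex 2 (omegaTheta ℤ)) = ex 4 (omegaTheta ℤ) := ex_ex 2 2 _
  have f4 : ex 2 (ex 12 (psi ℤ)) = ex (2 * 12) (psi ℤ) := ex_ex 2 12 _
  rw [h2, evenPart]
  simp only [map_sub, map_mul, map_pow, map_ofNat (ex 2 : ℤ⟦X⟧ →ₐ[ℤ] ℤ⟦X⟧) 2, ex_X, f1, f2, f3, f4]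
  linear_combination (ex (2 * 6) (phi ℤ) - 2 * X ^ 3 * ex (2 * 12) (psi ℤ)) * h1

/-- `φ(q) φ(-q)` is even. -/
lemma exists_phi_mul_sgn_phi : ∃ C : ℤ⟦X⟧, phi ℤ * sgn (phi ℤ) = ex 2 C := by
  have h := phi_eq_ex_four_add ℤ
  have h' := congrArg sgn h
  rw [map_add, map_mul, map_mul, map_ofNat (sgn : ℤ⟦X⟧ →+* ℤ⟦X⟧) 2, sgn_X, sgn_ex_two_mul 2 (phi ℤ),
    sgn_ex_two_mul 4 (psi ℤ)] at h'
  refine ⟨ex 2 (phi ℤ) ^ 2 - 4 * X * ex 4 (psi ℤ) ^ 2, ?_⟩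
  have f1 : ex 2 (ex 2 (phi ℤ)) = ex 4 (phi ℤ) := ex_ex 2 2 _
  have f2 : ex 2 (ex 4 (psi ℤ)) = ex 8 (psi ℤ) := ex_ex 2 4 _
  simp only [map_sub, map_mul, map_pow, map_ofNat (ex 2 : ℤ⟦X⟧ →ₐ[ℤ] ℤ⟦X⟧) 4, ex_X, f1, f2]
  change sgn (phi ℤ) = ex 4 (phi ℤ) + 2 * -X * ex 8 (psi ℤ) at h'
  rw [h']
  linear_combination (ex 4 (phi ℤ) + 2 * -X * ex 8 (psi ℤ)) * h

lemma progSection_three_sum {r : ℕ} (hr : r < 3) (A P₀ P₁ P₂ : ℤ⟦X⟧) (B : ℤ⟦X⟧)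
    (h : ex 3 A * B = X ^ 0 * ex 3 P₀ + X ^ 1 * ex 3 P₁ + X ^ 2 * ex 3 P₂) :
    A * progSection 3 r B = (if r = 0 then P₀ else 0) + (if r = 1 then P₁ else 0) +
      if r = 2 then P₂ else 0 := by
  rw [← progSection_expand_mul three_ne_zero hr, ← progSection_X_pow_mul_expand three_ne_zero hr
    (by norm_num : 0 < 3), ← progSection_X_pow_mul_expand three_ne_zero hr
    (by norm_num : 1 < 3), ← progSection_X_pow_mul_expand three_ne_zero hr
    (by norm_num : 2 < 3), ← map_add, ← map_add, ← h]

lemma progSection_two_sum {r : ℕ} (hr : r < 2) (A P₀ P₁ : ℤ⟦X⟧) (B : ℤ⟦X⟧)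
    (h : ex 2 A * B = X ^ 0 * ex 2 P₀ + X ^ 1 * ex 2 P₁) :
    A * progSection 2 r B = (if r = 0 then P₀ else 0) + if r = 1 then P₁ else 0 := by
  rw [← progSection_expand_mul two_ne_zero hr, ← progSection_X_pow_mul_expand two_ne_zero hr
    (by norm_num : 0 < 2), ← progSection_X_pow_mul_expand two_ne_zero hr
    (by norm_num : 1 < 2), ← map_add, ← h]

/-- The series `∑ S̄₉(6 n + r) q ^ n`. -/
noncomputable def schurSection (r : ℕ) : ℤ⟦X⟧ :=
  mk fun n => (schurOverpartitionCount 9 (6 * n + r) : ℤ)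

/-- The three-dissection of the generating function. It comes from those of `φ(q)` and
`φ(-q ^ 2) = A - B`, after multiplication by `A ^ 2 + A B + B ^ 2`, which turns the denominator into
the series `A ^ 3 - B ^ 3` in `q ^ 3`. -/
lemma progSection_three_schurSeries_mul (A O a D : ℤ⟦X⟧) (hA : A = ex 6 (sgn (phi ℤ)))
    (hO : O = ex 2 (sgn (omegaTheta ℤ))) (ha : a = ex 3 (phi ℤ))
    (hD : D = A ^ 3 - 8 * X ^ 2 * O ^ 3) :
    D * a * progSection 3 0 (schurSeries 9) = A ^ 2 * (a * A + 4 * X * omegaTheta ℤ * O) ∧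
    D * a * progSection 3 1 (schurSeries 9) = A * (2 * omegaTheta ℤ * A ^ 2 + 4 * X * a * O ^ 2) ∧
    D * a * progSection 3 2 (schurSeries 9) = 2 * O * A * (a * A + 4 * X * omegaTheta ℤ * O) := by
  have hG := schurSeries_nine_mul
  have hphi := phi_eq_ex_nine_add ℤ
  have e1 : ex 9 (phi ℤ) = ex 3 a := by rw [ha]; exact (ex_ex 3 3 _).symm
  have hsgn : ex 2 (sgn (phi ℤ)) = ex 3 A - 2 * X ^ 2 * ex 3 O := by
    have h := congrArg (ex 2) (congrArg sgn hphi)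
    rw [e1, ha, map_add, map_mul, map_mul, map_ofNat (sgn : ℤ⟦X⟧ →+* ℤ⟦X⟧) 2, sgn_X, sgn_ex_three,
      sgn_ex_three, sgn_ex_three, map_add, map_mul, map_mul, map_neg,
      map_ofNat (ex 2 : ℤ⟦X⟧ →ₐ[ℤ] ℤ⟦X⟧) 2, ex_X] at h
    have e3 : ex 2 (ex 3 (ex 3 (sgn (phi ℤ)))) = ex 3 A := by
      rw [hA, ← show ex 2 (ex 3 (sgn (phi ℤ))) = ex 6 (sgn (phi ℤ)) from ex_ex 2 3 _, ex_ex, ex_ex,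
        ex_ex, ex_ex]
    have e4 : ex 2 (ex 3 (sgn (omegaTheta ℤ))) = ex 3 O := by
      rw [hO, ex_ex, ex_ex]
    rw [h, e3, e4]
    ring
  have e5 : ex 9 (ex 2 (sgn (phi ℤ))) = ex 3 A := by
    rw [hA, ex_ex, ex_ex]
  rw [e5, hsgn, e1] at hG
  rw [hphi, e1] at hG
  have e6 : ex 3 (D * a) = (ex 3 A ^ 3 - 8 * X ^ 6 * ex 3 O ^ 3) * ex 3 a := by
    rw [hD]
    simp only [map_mul, map_sub, map_pow, ex_X, map_ofNat (ex 3 : ℤ⟦X⟧ →ₐ[ℤ] ℤ⟦X⟧) 8]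
    ring
  have key : ex 3 (D * a) * schurSeries 9 =
      X ^ 0 * ex 3 (A ^ 2 * (a * A + 4 * X * omegaTheta ℤ * O)) +
      X ^ 1 * ex 3 (A * (2 * omegaTheta ℤ * A ^ 2 + 4 * X * a * O ^ 2)) +
      X ^ 2 * ex 3 (2 * O * A * (a * A + 4 * X * omegaTheta ℤ * O)) := by
    rw [e6]
    simp only [map_mul, map_add, map_pow, ex_X, map_ofNat (ex 3 : ℤ⟦X⟧ →ₐ[ℤ] ℤ⟦X⟧) 4,
      map_ofNat (ex 3 : ℤ⟦X⟧ →ₐ[ℤ] ℤ⟦X⟧) 2]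
    linear_combination (ex 3 A ^ 2 + ex 3 A * (2 * X ^ 2 * ex 3 O) + (2 * X ^ 2 * ex 3 O) ^ 2) * hG
  refine ⟨?_, ?_, ?_⟩
  · simpa using progSection_three_sum (by norm_num : 0 < 3) _ _ _ _ _ key
  · simpa using progSection_three_sum (by norm_num : 1 < 3) _ _ _ _ _ key
  · simpa using progSection_three_sum (by norm_num : 2 < 3) _ _ _ _ _ key

/-- The series `∑ S̄₉(6 n + r) q ^ n` for `r = 1, 3, 5`, over a common denominator `D C` that is
invertible. They are parts of fixed parity of the sections modulo three, after `1 / φ(q ^ 3)` has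
been written as `φ(-q ^ 3)` over an even series. -/
lemma exists_schurSection_mul_eq :
    ∃ C : ℤ⟦X⟧, ex 3 (phi ℤ) * sgn (ex 3 (phi ℤ)) = ex 2 C ∧
    ∀ A O D : ℤ⟦X⟧, A = sgn (ex 3 (phi ℤ)) → O = sgn (omegaTheta ℤ) →
      D = A ^ 3 - 8 * X * O ^ 3 →
      D * C * schurSection 1 = 2 * (A ^ 3 * evenPart ℤ) ∧
      D * C * schurSection 3 = 4 * (A ^ 2 * evenPart ℤ * O) ∧
      D * C * schurSection 5 = 8 * (A * evenPart ℤ * O ^ 2) := by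
  obtain ⟨C₀, hC₀⟩ := exists_phi_mul_sgn_phi
  have hC : ex 3 (phi ℤ) * sgn (ex 3 (phi ℤ)) = ex 2 (ex 3 C₀) := by
    rw [sgn_ex_three, ← map_mul, hC₀, ex_ex, ex_ex]
  refine ⟨ex 3 C₀, hC, ?_⟩
  generalize ex 3 C₀ = C at hC ⊢
  rintro A O D hA hO hD
  obtain ⟨L, hL⟩ := omegaTheta_mul_sgn_phi
  have e1 : ex 6 (sgn (phi ℤ)) = ex 2 A := by rw [hA, sgn_ex_three]; exact (ex_ex 2 3 _).symm
  obtain ⟨h0, h1, h2⟩ := progSection_three_schurSeries_mul (ex 2 A) (ex 2 O) (ex 3 (phi ℤ))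
    (ex 2 D) e1.symm (by rw [hO]) rfl (by
      rw [hD]
      simp only [map_mul, map_sub, map_pow, ex_X, map_ofNat (ex 2 : ℤ⟦X⟧ →ₐ[ℤ] ℤ⟦X⟧) 8])
  rw [← hA] at hC hL
  have m2 := map_ofNat (ex 2 : ℤ⟦X⟧ →ₐ[ℤ] ℤ⟦X⟧) 2
  have m4 := map_ofNat (ex 2 : ℤ⟦X⟧ →ₐ[ℤ] ℤ⟦X⟧) 4
  have m8 := map_ofNat (ex 2 : ℤ⟦X⟧ →ₐ[ℤ] ℤ⟦X⟧) 8
  have s1 : schurSection 1 = progSection 2 0 (progSection 3 1 (schurSeries 9)) := by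
    ext n
    simp only [schurSection, schurSeries, coeff_progSection, coeff_mk]
    congr 2
    ring
  have s3 : schurSection 3 = progSection 2 1 (progSection 3 0 (schurSeries 9)) := by
    ext n
    simp only [schurSection, schurSeries, coeff_progSection, coeff_mk]
    congr 2
    ring
  have s5 : schurSection 5 = progSection 2 1 (progSection 3 2 (schurSeries 9)) := by
    ext n
    simp only [schurSection, schurSeries, coeff_progSection, coeff_mk]
    congr 2
    ring
  have k1 : ex 2 (D * C) * progSection 3 1 (schurSeries 9) =
      X ^ 0 * ex 2 (2 * (A ^ 3 * evenPart ℤ)) +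
        X ^ 1 * ex 2 (2 * A ^ 3 * L + 4 * A * C * O ^ 2) := by
    simp only [map_mul, map_add, map_pow, m2, m4]
    linear_combination A * h1 + 2 * ex 2 A ^ 3 * hL +
      (4 * X * ex 2 A * ex 2 O ^ 2 - ex 2 D * progSection 3 1 (schurSeries 9)) * hC
  have k3 : ex 2 (D * C) * progSection 3 0 (schurSeries 9) =
      X ^ 0 * ex 2 (C * A ^ 3 + 4 * X * A ^ 2 * L * O) +
        X ^ 1 * ex 2 (4 * (A ^ 2 * evenPart ℤ * O)) := by
    simp only [map_mul, map_add, map_pow, m4, ex_X]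
    linear_combination A * h0 + 4 * X * ex 2 A ^ 2 * ex 2 O * hL +
      (ex 2 A ^ 3 - ex 2 D * progSection 3 0 (schurSeries 9)) * hC
  have k5 : ex 2 (D * C) * progSection 3 2 (schurSeries 9) =
      X ^ 0 * ex 2 (2 * O * A * (C * A + 4 * X * L * O)) +
        X ^ 1 * ex 2 (8 * (A * evenPart ℤ * O ^ 2)) := by
    simp only [map_mul, map_add, map_pow, m2, m4, m8, ex_X]
    linear_combination A * h2 + 8 * X * ex 2 A * ex 2 O ^ 2 * hL +
      (2 * ex 2 O * ex 2 A ^ 2 - ex 2 D * progSection 3 2 (schurSeries 9)) * hC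
  rw [s1, s3, s5]
  refine ⟨?_, ?_, ?_⟩
  · simpa using progSection_two_sum (by norm_num : 0 < 2) _ _ _ _ k1
  · simpa using progSection_two_sum (by norm_num : 1 < 2) _ _ _ _ k3
  · simpa using progSection_two_sum (by norm_num : 1 < 2) _ _ _ _ k5

end Sections

/-! ### The sections modulo powers of two -/

section ModFour

lemma four_eq_zero_zmod_four : (4 : (ZMod 4)⟦X⟧) = 0 := by
  rw [← map_ofNat C 4, show (OfNat.ofNat 4 : ZMod 4) = 0 from rfl, map_zero]

lemma two_mul_sgn (A : (ZMod 4)⟦X⟧) : 2 * sgn A = 2 * A := by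
  ext n
  rw [two_mul, two_mul, map_add, map_add, coeff_rescale]
  rcases neg_one_pow_eq_or (ZMod 4) n with h | h <;> rw [h]
  · ring
  · generalize coeff n A = c
    revert c
    decide

lemma map_evenPart {R S : Type*} [CommRing R] [CommRing S] (f : R →+* S) :
    map f (evenPart R) = evenPart S := by
  have h2 : map f (2 : R⟦X⟧) = 2 := map_ofNat _ 2
  simp only [evenPart, map_sub, map_mul, map_pow, map_expand, map_X, map_psi, map_omegaTheta,
    map_pentTheta, map_phi, h2]

/-- Reduction modulo four of integral power series. -/
noncomputable abbrev modFour : ℤ⟦X⟧ →+* (ZMod 4)⟦X⟧ := map (Int.castRingHom (ZMod 4))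

lemma phi_four : phi (ZMod 4) = 1 + 2 * modFour halfPhi := by
  have h2 : modFour (2 : ℤ⟦X⟧) = 2 := map_ofNat _ 2
  rw [← map_phi (Int.castRingHom (ZMod 4)), phi_eq_one_add, map_add, map_mul, h2, map_one]

lemma ex_phi_four (m : ℕ) [NeZero m] :
    ex m (phi (ZMod 4)) = 1 + 2 * ex m (modFour halfPhi) := by
  rw [phi_four, map_add, map_mul, map_one, map_ofNat (ex m : (ZMod 4)⟦X⟧ →ₐ[ZMod 4] _) 2]

/-- Modulo four, `φ(q ^ 3)` is its own inverse and the even series `φ(q ^ 3) φ(-q ^ 3)` is `1`,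
which reduces the sections to products of theta functions. -/
lemma exists_schurSection_eq :
    ∃ t₁ t₃ t₅ : ℤ⟦X⟧,
      (schurSection 1 = 2 * t₁ ∧ modFour t₁ = evenPart (ZMod 4)) ∧
      (schurSection 3 = 4 * t₃ ∧
        modFour t₃ = ex 3 (phi (ZMod 4)) * (evenPart (ZMod 4) * sgn (omegaTheta (ZMod 4)))) ∧
      (schurSection 5 = 8 * t₅ ∧
        modFour t₅ = evenPart (ZMod 4) * sgn (omegaTheta (ZMod 4)) ^ 2) := by
  obtain ⟨C, hC, h⟩ := exists_schurSection_mul_eq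
  obtain ⟨h1, h3, h5⟩ := h _ _ _ rfl rfl rfl
  clear h
  set A := sgn (ex 3 (phi ℤ)) with hA
  set O := sgn (omegaTheta ℤ) with hO
  set D := A ^ 3 - 8 * X * O ^ 3 with hD
  have hp : constantCoeff (ex 3 (phi ℤ)) = 1 := by
    rw [constantCoeff_expand]; exact constantCoeff_theta le_rfl le_rfl
  have hA0 : constantCoeff A = 1 := by
    rw [hA, ← coeff_zero_eq_constantCoeff_apply, coeff_rescale, coeff_zero_eq_constantCoeff_apply,
      hp, pow_zero, one_mul]
  have hC0 : constantCoeff C = 1 := by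
    have := congrArg constantCoeff hC
    rw [map_mul, hp, hA0, constantCoeff_expand] at this
    rw [← this, one_mul]
  have hD0 : constantCoeff D = 1 := by
    simp [hD, hA0]
  have hu : IsUnit (D * C) := by
    rw [isUnit_iff_constantCoeff, map_mul, hD0, hC0]
    simp
  obtain ⟨V, hV⟩ := hu.exists_right_inv
  have four := four_eq_zero_zmod_four
  have m8 : modFour (8 : ℤ⟦X⟧) = 8 := map_ofNat _ 8
  have hA4 : modFour A = ex 3 (phi (ZMod 4)) := by
    rw [hA, map_sgn, map_expand, map_phi, ex_phi_four, map_add, map_mul, map_one,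
      map_ofNat (sgn : (ZMod 4)⟦X⟧ →+* _) 2, two_mul_sgn]
  have hsq : ex 3 (phi (ZMod 4)) ^ 2 = 1 := by
    rw [ex_phi_four]
    linear_combination (ex 3 (modFour halfPhi) + ex 3 (modFour halfPhi) ^ 2) * four
  have hD4 : modFour D = ex 3 (phi (ZMod 4)) := by
    rw [hD, map_sub, map_mul, map_mul, m8, map_pow, hA4]
    linear_combination ex 3 (phi (ZMod 4)) * hsq -
      2 * modFour X * modFour (O ^ 3) * four
  have hC4 : modFour C = 1 := by
    refine expand_injective two_ne_zero ?_
    rw [map_one, ← map_expand, ← hC, map_mul, hA4, map_expand, map_phi]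
    linear_combination hsq
  have hO4 : modFour O = sgn (omegaTheta (ZMod 4)) := by rw [hO, map_sgn, map_omegaTheta]
  have hK4 : modFour (evenPart ℤ) = evenPart (ZMod 4) := map_evenPart _
  have hV4 : ex 3 (phi (ZMod 4)) * modFour V = 1 := by
    have := congrArg modFour hV
    rwa [map_mul, map_mul, hD4, hC4, mul_one, map_one] at this
  have hV4' : modFour V = ex 3 (phi (ZMod 4)) := by
    linear_combination ex 3 (phi (ZMod 4)) * hV4 - modFour V * hsq
  refine ⟨A ^ 3 * evenPart ℤ * V, A ^ 2 * evenPart ℤ * O * V, A * evenPart ℤ * O ^ 2 * V,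
    ⟨?_, ?_⟩, ⟨?_, ?_⟩, ?_, ?_⟩
  · linear_combination V * h1 - schurSection 1 * hV
  · rw [map_mul, map_mul, map_pow, hA4, hK4, hV4']
    linear_combination evenPart (ZMod 4) * (ex 3 (phi (ZMod 4)) ^ 2 + 1) * hsq
  · linear_combination V * h3 - schurSection 3 * hV
  · rw [map_mul, map_mul, map_mul, map_pow, hA4, hK4, hV4', hO4]
    linear_combination evenPart (ZMod 4) * sgn (omegaTheta (ZMod 4)) * ex 3 (phi (ZMod 4)) * hsq
  · linear_combination V * h5 - schurSection 5 * hV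
  · rw [map_mul, map_mul, map_mul, map_pow, hA4, hK4, hV4', hO4]
    linear_combination evenPart (ZMod 4) * sgn (omegaTheta (ZMod 4)) ^ 2 * hsq

lemma evenPart_eq_ex_two {R : Type*} [CommRing R] :
    evenPart R = ex 2 (ex 2 (pentTheta R) * ex 3 (phi R) -
      2 * X * (omegaTheta R * ex 6 (psi R))) := by
  have f1 : ex 2 (ex 2 (pentTheta R)) = ex 4 (pentTheta R) := ex_ex 2 2 _
  have f2 : ex 2 (ex 3 (phi R)) = ex 6 (phi R) := ex_ex 2 3 _
  have f3 : ex 2 (ex 6 (psi R)) = ex 12 (psi R) := ex_ex 2 6 _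
  rw [map_sub, map_mul, map_mul, map_mul, map_mul, map_ofNat (ex 2 : R⟦X⟧ →ₐ[R] _) 2, ex_X, f1, f2,
    f3, evenPart]

lemma coeff_evenPart_of_odd {R : Type*} [CommRing R] (n : ℕ) :
    coeff (2 * n + 1) (evenPart R) = 0 := by
  rw [evenPart_eq_ex_two]
  exact coeff_expand_of_not_dvd _ _ _ (by omega)

/-- Modulo four, the part of odd degree of `∑ (S̄₉(6 n + 5) / 8) q ^ n` is supported on the
exponents `4 n + 1`. -/
lemma coeff_evenPart_mul_sq (n : ℕ) :
    coeff (4 * n + 3) (evenPart (ZMod 4) * sgn (omegaTheta (ZMod 4)) ^ 2) = 0 := by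
  have four := four_eq_zero_zmod_four
  have hO : sgn (omegaTheta (ZMod 4)) =
      ex 8 (pentTheta (ZMod 4)) - X * ex 4 (omegaTheta (ZMod 4)) := by
    have h := congrArg sgn (omegaTheta_eq_ex_eight_add (ZMod 4))
    rw [map_add, map_mul, sgn_X] at h
    rw [h, show sgn (ex 8 (pentTheta (ZMod 4))) = ex 8 (pentTheta (ZMod 4)) from
      sgn_ex_two_mul 4 _, show sgn (ex 4 (omegaTheta (ZMod 4))) = ex 4 (omegaTheta (ZMod 4)) from
      sgn_ex_two_mul 2 _]
    ring
  have f1 : ex 2 (ex 4 (pentTheta (ZMod 4))) = ex 8 (pentTheta (ZMod 4)) := ex_ex 2 4 _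
  have f2 : ex 2 (ex 2 (omegaTheta (ZMod 4))) = ex 4 (omegaTheta (ZMod 4)) := ex_ex 2 2 _
  have f3 : ex 4 (ex 2 (pentTheta (ZMod 4))) = ex 8 (pentTheta (ZMod 4)) := ex_ex 4 2 _
  obtain ⟨K, hK⟩ : ∃ K, evenPart (ZMod 4) = ex 2 K := ⟨_, evenPart_eq_ex_two⟩
  have h : evenPart (ZMod 4) * sgn (omegaTheta (ZMod 4)) ^ 2 =
      ex 2 (K * (ex 4 (pentTheta (ZMod 4)) ^ 2 + X * ex 2 (omegaTheta (ZMod 4)) ^ 2)) +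
      X ^ 1 * ex 4 (-2 * (pentTheta (ZMod 4) * ex 2 (pentTheta (ZMod 4)) *
        omegaTheta (ZMod 4))) := by
    simp only [map_mul, map_add, map_pow, map_neg, ex_X, f1, f2, f3, ← hK,
      map_ofNat (ex 4 : (ZMod 4)⟦X⟧ →ₐ[ZMod 4] _) 2]
    rw [hO, evenPart, ex_phi_four]
    linear_combination (-X * ex 8 (pentTheta (ZMod 4)) * ex 4 (omegaTheta (ZMod 4)) *
      (ex 4 (pentTheta (ZMod 4)) * ex 6 (modFour halfPhi) -
        X ^ 2 * (ex 2 (omegaTheta (ZMod 4)) * ex 12 (psi (ZMod 4))))) * four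
  rw [h, map_add, coeff_expand_of_not_dvd _ _ _ (by omega), coeff_X_pow_mul', if_pos (by omega),
    coeff_expand_of_not_dvd _ _ _ (by omega), add_zero]

/-- The double of a congruence modulo two is a congruence modulo four. -/
lemma two_mul_modFour_eq {A B H : ℤ⟦X⟧} (h : A = B + 2 * H) :
    2 * modFour A = 2 * modFour B := by
  have h2 : modFour (2 : ℤ⟦X⟧) = 2 := map_ofNat _ 2
  rw [h, map_add, map_mul, h2]
  linear_combination modFour H * four_eq_zero_zmod_four

/-- Modulo four, the series `∑ (S̄₉(6 n + 3) / 4) q ^ n` is negated by the section `3 n + 1`, and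
its section `3 n + 2` is twice the series `∑ (S̄₉(6 n + 5) / 8) q ^ n`. -/
lemma progSection_three_mod_four :
    progSection 3 1 (ex 3 (phi (ZMod 4)) * (evenPart (ZMod 4) * sgn (omegaTheta (ZMod 4)))) =
      -(ex 3 (phi (ZMod 4)) * (evenPart (ZMod 4) * sgn (omegaTheta (ZMod 4)))) ∧
    progSection 3 2 (ex 3 (phi (ZMod 4)) * (evenPart (ZMod 4) * sgn (omegaTheta (ZMod 4)))) =
      2 * (evenPart (ZMod 4) * sgn (omegaTheta (ZMod 4)) ^ 2) := by
  have four := four_eq_zero_zmod_four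
  set Om := omegaTheta (ZMod 4) with hOm
  set V := sgn (Om * ex 4 (pentTheta (ZMod 4))) with hV
  set Z := Om * ex 2 Om with hZ
  set P := psi (ZMod 4)
  set h := modFour halfPhi with hh
  have hVs : V = sgn Om * ex 4 (pentTheta (ZMod 4)) := by
    rw [hV, map_mul]
    congr 1
    exact sgn_ex_two_mul 2 _
  have hsgn := two_mul_sgn Om
  have hexp : ex 3 (phi (ZMod 4)) * (evenPart (ZMod 4) * sgn Om) =
      ex 3 (phi (ZMod 4)) * (ex 3 (ex 2 (phi (ZMod 4))) * V) +
        ex 3 (phi (ZMod 4)) * (ex 3 (ex 4 P) * (-2 * (X ^ 2 * Z))) := by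
    have f1 : ex 3 (ex 2 (phi (ZMod 4))) = ex 6 (phi (ZMod 4)) := ex_ex 3 2 _
    have f2 : ex 3 (ex 4 P) = ex 12 P := ex_ex 3 4 _
    rw [f1, f2, hVs, evenPart, hZ]
    linear_combination -ex 3 (phi (ZMod 4)) * X ^ 2 * ex 2 Om * ex 12 P * hsgn
  have hsec : ∀ r < 3, progSection 3 r
      (ex 3 (phi (ZMod 4)) * (evenPart (ZMod 4) * sgn Om)) =
      phi (ZMod 4) * (ex 2 (phi (ZMod 4)) * progSection 3 r V) -
        2 * phi (ZMod 4) * (ex 4 P * progSection 3 r (X ^ 2 * Z)) := by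
    intro r hr
    have h2 : ∀ Y : (ZMod 4)⟦X⟧, progSection 3 r (-2 * Y) = -2 * progSection 3 r Y := by
      intro Y
      rw [neg_mul, neg_mul, two_mul, two_mul, map_neg, map_add]
    rw [hexp, map_add, progSection_expand_mul three_ne_zero hr,
      progSection_expand_mul three_ne_zero hr, progSection_expand_mul three_ne_zero hr,
      progSection_expand_mul three_ne_zero hr, h2]
    ring
  have hV1 : progSection 3 1 V = -V := by
    have := progSection_three_one_omegaTheta_mul (ZMod 4)
    rw [← hOm] at this
    rw [hV]
    nth_rewrite 2 [← this]
    ext n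
    simp only [coeff_progSection, coeff_rescale, map_neg]
    rw [pow_succ, pow_mul, show (-1 : ZMod 4) ^ 3 = -1 by decide]
    ring
  have hV2 : progSection 3 2 V = 2 * X * ex 12 P * Om := by
    have := progSection_three_two_omegaTheta_mul (ZMod 4)
    rw [← hOm] at this
    have h2 : progSection 3 2 V = sgn (progSection 3 2 (Om * ex 4 (pentTheta (ZMod 4)))) := by
      rw [hV]
      ext n
      simp only [coeff_progSection, coeff_rescale]
      rw [pow_add, pow_mul, show (-1 : ZMod 4) ^ 3 = -1 by decide,
        show (-1 : ZMod 4) ^ 2 = 1 by decide, mul_one]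
    rw [h2, this, mul_assoc, mul_assoc, map_mul, map_ofNat (sgn : (ZMod 4)⟦X⟧ →+* _) 2, two_mul_sgn]
  have hZ1 : progSection 3 1 (X ^ 2 * Z) = X * Z := by
    have := progSection_three_two_omegaTheta_mul_omegaTheta (ZMod 4)
    rw [← hOm, ← hZ] at this
    nth_rewrite 2 [← this]
    ext n
    rw [coeff_progSection, coeff_X_pow_mul']
    rcases n with _ | n
    · simp
    · rw [if_pos (by omega), coeff_succ_X_mul, coeff_progSection]
      congr 2
  have hZ2 : progSection 3 2 (X ^ 2 * Z) = Om * ex 6 (phi (ZMod 4)) := by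
    have := progSection_three_zero_omegaTheta_mul_omegaTheta (ZMod 4)
    rw [← hOm, ← hZ] at this
    rw [← this]
    ext n
    rw [coeff_progSection, coeff_X_pow_mul', if_pos (by omega), coeff_progSection]
    rfl
  have hV0 : 2 * V = 2 * (Om * ex 4 (pentTheta (ZMod 4))) := two_mul_sgn _
  obtain ⟨H, hH⟩ := exists_halfPhiSum_mul_eq
  obtain ⟨H', hH'⟩ := exists_omegaTheta_mul_eq
  have c1 := two_mul_modFour_eq hH
  have c2 := two_mul_modFour_eq hH'
  simp only [halfPhiSum, map_mul, map_add, map_pow, map_expand, map_X, map_psi, map_omegaTheta,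
    map_pentTheta] at c1 c2
  change 2 * ((h + ex 2 h + ex 3 h + ex 6 h) * (Om * ex 4 (pentTheta (ZMod 4)))) =
    2 * (Om * ex 2 Om * (X * ex 4 P + X ^ 2 * ex 12 P)) at c1
  change 2 * (Om * (ex 4 P + X * ex 12 P)) = 2 * (Om ^ 2 * ex 4 (pentTheta (ZMod 4))) at c2
  constructor
  · have f1 : ex 3 (ex 2 (phi (ZMod 4))) = ex 6 (phi (ZMod 4)) := ex_ex 3 2 _
    have f2 : ex 3 (ex 4 P) = ex 12 P := ex_ex 3 4 _
    rw [hsec 1 (by norm_num), hV1, hZ1, hexp, f1, f2, ex_phi_four, ex_phi_four, ex_phi_four,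
      phi_four, ← hh]
    linear_combination (h + ex 2 h + ex 3 h + ex 6 h) * hV0 + c1 +
      (V * (ex 3 h * ex 6 h - h * ex 2 h - h - ex 2 h) - h * ex 4 P * X * Z -
        ex 3 h * X ^ 2 * Z * ex 12 P) * four
  · rw [hsec 2 (by norm_num), hV2, hZ2, evenPart, ← hOm, ex_phi_four, ex_phi_four, phi_four, ← hh]
    linear_combination c2 - ex 4 (pentTheta (ZMod 4)) * (sgn Om + Om) * hsgn +
      (X * ex 12 P * Om * (h + ex 2 h + 2 * h * ex 2 h) -
        ex 4 P * Om * (1 + h + ex 6 h + 2 * h * ex 6 h) -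
        ex 6 h * ex 4 (pentTheta (ZMod 4)) * sgn Om ^ 2 +
        X ^ 2 * ex 2 Om * ex 12 P * sgn Om ^ 2) * four

end ModFour

/-! ### The congruences -/

section Congruences

lemma intCast_coeff_eq_modFour (A : ℤ⟦X⟧) (n : ℕ) :
    ((coeff n A : ℤ) : ZMod 4) = coeff n (modFour A) := by
  simp

lemma schurCount_eq_coeff (r n : ℕ) :
    (schurOverpartitionCount 9 (6 * n + r) : ℤ) = coeff n (schurSection r) := by
  simp [schurSection]

lemma coeff_eq_mul_coeff {A B : ℤ⟦X⟧} {c : ℕ} (h : A = (c : ℤ⟦X⟧) * B) (n : ℕ) :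
    coeff n A = c * coeff n B := by
  rw [h, show (c : ℤ⟦X⟧) = C (c : ℤ) by simp, coeff_C_mul]

theorem schurCount_twelve_mul_add_seven (n : ℕ) :
    (schurOverpartitionCount 9 (12 * n + 7) : ℤ) ≡ 0 [ZMOD 8] := by
  obtain ⟨t, -, -, ⟨h, ht⟩, -, -⟩ := exists_schurSection_eq
  rw [show 12 * n + 7 = 6 * (2 * n + 1) + 1 by ring, schurCount_eq_coeff,
    coeff_eq_mul_coeff (c := 2) h]
  have h4 : ((coeff (2 * n + 1) t : ℤ) : ZMod 4) = ((0 : ℤ) : ZMod 4) := by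
    rw [intCast_coeff_eq_modFour, ht, coeff_evenPart_of_odd, Int.cast_zero]
  rw [ZMod.intCast_eq_intCast_iff_dvd_sub] at h4
  rw [Int.modEq_zero_iff_dvd]
  push_cast at h4 ⊢
  omega

theorem schurCount_twentyfour_mul_add_twentythree (n : ℕ) :
    (schurOverpartitionCount 9 (24 * n + 23) : ℤ) ≡ 0 [ZMOD 32] := by
  obtain ⟨-, -, t, -, -, h, ht⟩ := exists_schurSection_eq
  rw [show 24 * n + 23 = 6 * (4 * n + 3) + 5 by ring, schurCount_eq_coeff,
    coeff_eq_mul_coeff (c := 8) h]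
  have h4 : ((coeff (4 * n + 3) t : ℤ) : ZMod 4) = ((0 : ℤ) : ZMod 4) := by
    rw [intCast_coeff_eq_modFour, ht, coeff_evenPart_mul_sq, Int.cast_zero]
  rw [ZMod.intCast_eq_intCast_iff_dvd_sub] at h4
  rw [Int.modEq_zero_iff_dvd]
  push_cast at h4 ⊢
  omega

theorem schurCount_three_mul_of_three_mod_six (n : ℕ) :
    (schurOverpartitionCount 9 (3 * (6 * n + 3)) : ℤ) ≡
      -(schurOverpartitionCount 9 (6 * n + 3) : ℤ) [ZMOD 16] := by
  obtain ⟨-, t, -, -, ⟨h, ht⟩, -⟩ := exists_schurSection_eq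
  rw [show 3 * (6 * n + 3) = 6 * (3 * n + 1) + 3 by ring, schurCount_eq_coeff, schurCount_eq_coeff,
    coeff_eq_mul_coeff (c := 4) h, coeff_eq_mul_coeff (c := 4) h]
  have h4 : ((coeff (3 * n + 1) t : ℤ) : ZMod 4) = ((-coeff n t : ℤ) : ZMod 4) := by
    have := congrArg (coeff n) progSection_three_mod_four.1
    rw [← ht, coeff_progSection, map_neg, ← intCast_coeff_eq_modFour,
      ← intCast_coeff_eq_modFour] at this
    rw [this, Int.cast_neg]
  rw [ZMod.intCast_eq_intCast_iff_dvd_sub] at h4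
  rw [Int.modEq_iff_dvd]
  push_cast at h4 ⊢
  omega

/-- The divisibility by eight makes signs immaterial modulo sixteen on this progression. -/
theorem schurCount_three_mul_of_five_mod_six (n : ℕ) :
    (schurOverpartitionCount 9 (3 * (6 * n + 5)) : ℤ) ≡
      (schurOverpartitionCount 9 (6 * n + 5) : ℤ) [ZMOD 16] ∧
    (8 : ℤ) ∣ schurOverpartitionCount 9 (6 * n + 5) := by
  obtain ⟨-, t, s, -, ⟨h, ht⟩, h', hs⟩ := exists_schurSection_eq
  rw [show 3 * (6 * n + 5) = 6 * (3 * n + 2) + 3 by ring, schurCount_eq_coeff, schurCount_eq_coeff,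
    coeff_eq_mul_coeff (c := 4) h, coeff_eq_mul_coeff (c := 8) h']
  have h4 : ((coeff (3 * n + 2) t : ℤ) : ZMod 4) = ((2 * coeff n s : ℤ) : ZMod 4) := by
    have := congrArg (coeff n) progSection_three_mod_four.2
    rw [← ht, ← hs, two_mul, coeff_progSection, map_add, ← intCast_coeff_eq_modFour,
      ← intCast_coeff_eq_modFour] at this
    rw [this]
    push_cast
    ring
  rw [ZMod.intCast_eq_intCast_iff_dvd_sub] at h4
  rw [Int.modEq_iff_dvd]
  push_cast at h4 ⊢
  omega

theorem schurCount_three_pow_mul (n α : ℕ) :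
    (schurOverpartitionCount 9 (6 * n + 3) : ℤ) ≡
      (-1) ^ α * (schurOverpartitionCount 9 (3 ^ α * (6 * n + 3)) : ℤ) [ZMOD 16] := by
  induction α generalizing n with
  | zero => simp [Int.ModEq.refl]
  | succ α ih =>
    have h1 := ih (3 * n + 1)
    have h2 := schurCount_three_mul_of_three_mod_six n
    rw [show 6 * (3 * n + 1) + 3 = 3 * (6 * n + 3) by ring, ← mul_assoc, ← pow_succ] at h1
    have h3 := (h2.symm.trans h1).neg
    rwa [neg_neg, ← neg_mul, ← mul_neg_one, ← pow_succ] at h3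

theorem schurCount_three_pow_mul_of_five_mod_six (n α : ℕ) :
    (schurOverpartitionCount 9 (6 * n + 5) : ℤ) ≡
      (schurOverpartitionCount 9 (3 ^ α * (6 * n + 5)) : ℤ) [ZMOD 16] := by
  rcases α with _ | α
  · simp [Int.ModEq.refl]
  · have h1 := schurCount_three_pow_mul (3 * n + 2) α
    obtain ⟨h2, h3⟩ := schurCount_three_mul_of_five_mod_six n
    rw [show 6 * (3 * n + 2) + 3 = 3 * (6 * n + 5) by ring, ← mul_assoc, ← pow_succ] at h1
    have h4 := h2.symm.trans h1
    rcases neg_one_pow_eq_or ℤ α with h | h <;> rw [h] at h4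
    · rwa [one_mul] at h4
    · rw [Int.modEq_iff_dvd] at h4 ⊢
      omega

end Congruences

theorem theorem3p3 (n α : ℕ) :
    (schurOverpartitionCount 9 (12 * n + 7) : ℤ) ≡ 0 [ZMOD 8] ∧
    (schurOverpartitionCount 9 (6 * n + 3) : ℤ) ≡
      (-1) ^ α * (schurOverpartitionCount 9 (3 ^ α * (6 * n + 3)) : ℤ) [ZMOD 16] ∧
    (schurOverpartitionCount 9 (6 * n + 5) : ℤ) ≡
      (schurOverpartitionCount 9 (3 ^ α * (6 * n + 5)) : ℤ) [ZMOD 16] ∧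
    (schurOverpartitionCount 9 (24 * n + 23) : ℤ) ≡ 0 [ZMOD 32] :=
  ⟨schurCount_twelve_mul_add_seven n, schurCount_three_pow_mul n α,
    schurCount_three_pow_mul_of_five_mod_six n α, schurCount_twentyfour_mul_add_twentythree n⟩
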